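/- **Setting.** In online bin covering, items of an input sequence $\sigma$ of length $n$, with sizes in $]0,1[$, arrive one by one, and each has to be put into a bin at once and irrevocably. A bin is covered if its items have total size at least $1$. $|\mathrm{OPT}(\sigma)|$ is the maximum number of bins that can be covered with the items of $\sigma$. A strategy with advice is deterministic and may read bits from an unbounded tape written by an oracle that knows $\sigma$ and the strategy; its advice complexity is the number of bits read. Items of size at least $1/2$ are 2-items, the others are small. Dual Next Fit (DNF) fills one active bin until it is covered, then opens the next one. **The strategy $\mathrm{DH}_2^b$.** The strategy reads the number $b$ in self-delimiting form, then a constant number of selection bits, integers $r, g, x_L, x_R, \mu, \eta$, each given by $b$ significant bits and a $b$-bit exponent, and fixed point values $\bar d$ and $\underline s<\overline s=\underline s+2^{-b}$ with $b$ fractional bits. One selection bit may tell it to pack 2-items and small items separately, each class by DNF. Otherwise it opens $r$ reserved bins and proceeds as follows. *2-items.* The sequence of 2-items is split into three subsequences of length $r$ and a last one with the rest; the last one is split into chunks of lengths $x_L$, $x_R$ and the rest. "Separate bins" are packed by DNF, i.e. two by two. The selection bits choose one of these cases. 1. One of the first three subsequences is placed in the reserved bins, one item per bin; then the largest $g-1$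 of these items are declared good, and the following 2-items are added to reserved bins whose 2-item was not declared good, until each of these has two. All other 2-items go to separate bins. 2. (a) The first two chunks of the last subsequence are treated as the chosen subsequence in case 1. (b) The first chunk is placed singly in reserved bins, the largest $g$ of its items are declared good, the second chunk is used to complete the reserved bins whose 2-item was not declared good, its remaining items go to separate bins, and the third chunk goes singly into the remaining reserved bins. (c) The second and third chunks go singly into reserved bins. All other 2-items (and those for which there is no reserved bin left) go to separate bins. *Small items.* Small items of size at least $\bar d$ are black, the others white. Of the reserved bins, $\mu$ (at most $r$) are black reserved bins, which receive one black item each: any black item of size at most $\underline s$, and at most $\eta$ items of size in $]\underline s,\overline s]$. White items are placed, by Dual Worst Fit, in the other reserved bin that contains the least amount of white items, until each of these contains white items of total size at least $\bar d$. All other small items are packed by DNF in separate bins. **Theorem.** With $b=\lceil 2\log\log n\rceil$ (for $n\le 2$, $b=0$), the strategy $\mathrm{DH}_2^{b}$ uses $O(\log\log n)$ bits of advice and has asymptotic competitive ratio at least $135/242-O(1/\log n)$, where $135/242\approx 0.5578$. That is, there are functions $f(n)=O(\log\log n)$ and $e(n)=O(1/\log n)$ and a constant $C$ such that for every input sequence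 $\sigma$, with $n=|\sigma|$, the oracle can write a tape, beginning with the self-delimiting code of $b$, on which the strategy reads at most $f(n)$ bits and covers at least $$\Bigl(\frac{135}{242}-e(n)\Bigr)\,|\mathrm{OPT}(\sigma)|-C$$ bins. -/

import Mathlib

open Filter Asymptotics

namespace BinCovering

noncomputable section

/-! ### Bin covering -/

/-- An input sequence of online bin covering: all items lie strictly between 0 and 1. -/
def IsInput (σ : List ℝ) : Prop := ∀ v ∈ σ, 0 < v ∧ v < 1

open Classical in
/-- Total size of the items that the placement `f` puts into bin `j`. -/
def load {β : Type} (σ : List ℝ) (f : Fin σ.length → β) (j : β) : ℝ :=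
  ∑ i : Fin σ.length, if f i = j then σ.get i else 0

open Classical in
/-- Number of bins covered by the placement `f` (bins that receive no item are never covered). -/
def numCovered {β : Type} (σ : List ℝ) (f : Fin σ.length → β) : ℕ :=
  ((Finset.univ.image f).filter fun j => 1 ≤ load σ f j).card

/-- The optimum: the maximum number of bins covered by any placement of all the items
(a placement uses at most `σ.length` bins). -/
def opt (σ : List ℝ) : ℕ :=
  (Finset.univ : Finset (Fin σ.length → Fin σ.length)).sup fun f => numCovered σ f

/-! ### Online strategies with an advice tape -/

/-- An unbounded advice tape. -/
abbrev Tape := ℕ → Bool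

/-- A deterministic online strategy reading an advice tape, with bins named by elements of `β`.
`place t h v` is the bin that receives item `v` when the items `h` arrived before it, and
`bitsRead t h` is the number of tape bits read while the items `h` were served (`⊤` if the reading
never ends). All behaviour is determined by the bits that have been read. -/
structure AdviceStrategy (β : Type) where
  place : Tape → List ℝ → ℝ → β
  bitsRead : Tape → List ℝ → ℕ∞
  bitsRead_mono : ∀ t h v, bitsRead t h ≤ bitsRead t (h ++ [v])
  bitsRead_congr : ∀ t u h, (∀ i : ℕ, (i : ℕ∞) < bitsRead t h → t i = u i) →
    bitsRead u h = bitsRead t h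
  place_congr : ∀ t u h v, (∀ i : ℕ, (i : ℕ∞) < bitsRead t (h ++ [v]) → t i = u i) →
    place u h v = place t h v

/-- The placement produced by the strategy on the input `σ` with advice tape `t`. -/
def AdviceStrategy.placement {β : Type} (A : AdviceStrategy β) (t : Tape) (σ : List ℝ) :
    Fin σ.length → β :=
  fun i => A.place t (σ.take i) (σ.get i)

/-- Number of bins covered by the strategy on the input `σ` with advice tape `t`. -/
def AdviceStrategy.covered {β : Type} (A : AdviceStrategy β) (t : Tape) (σ : List ℝ) : ℕ :=
  numCovered σ (A.placement t σ)

/-! ### Dual Next Fit -/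

/-- State of Dual Next Fit: index and content of the active bin. -/
structure DNF where
  active : ℕ
  content : ℝ

/-- Dual Next Fit puts the item `v` into the active bin; if this covers the bin, the next bin is
opened. -/
def DNF.insert (s : DNF) (v : ℝ) : DNF :=
  if 1 ≤ s.content + v then ⟨s.active + 1, 0⟩ else ⟨s.active, s.content + v⟩

/-! ### The advice of the modified Dual Harmonic strategy -/

/-- The advice values, after decoding. -/
structure Advice where
  /-- use the strategy without advice (both item classes are packed by Dual Next Fit) -/
  plain : Bool
  /-- which of the four consecutive subsequences of 2-items is to use the reserved bins:
  0, 1, 2 are those of length `reserved`, 3 is the last one -/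
  part : ℕ
  /-- treatment of the three chunks of the last subsequence: 0 = the first two chunks go singly into
  reserved bins, and the third is matched with those not declared good; 1 = the first chunk goes
  singly into reserved bins, the second is matched with those not declared good, and the third goes
  singly into the remaining reserved bins; otherwise the first chunk goes pairwise into separate
  bins, and the other two go singly into reserved bins -/
  variant : ℕ
  /-- number of reserved bins -/
  reserved : ℕ
  /-- approximate number of 2-items to be declared good -/
  good : ℕ
  /-- length of the first chunk of the last subsequence -/
  chunkL : ℕ
  /-- length of the second chunk of the last subsequence -/
  chunkR : ℕ
  /-- number of black reserved bins -/
  black : ℕ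
  /-- number of black items of size in `]sDown, sUp]` that may go to black reserved bins -/
  blackExtra : ℕ
  /-- small items of size at least `dUp` are black, the others are white -/
  dUp : ℝ
  sDown : ℝ
  sUp : ℝ

/-- The number written (least significant bit first) in the `len` cells from `start` on. -/
def natAt (t : Tape) (start len : ℕ) : ℕ :=
  ∑ i ∈ Finset.range len, if t (start + i) then 2 ^ i else 0

/-- A `b`-bit approximate integer: `b` significant bits, followed by a `b`-bit exponent. -/
def approxAt (b : ℕ) (t : Tape) (start : ℕ) : ℕ :=
  natAt t start b * 2 ^ natAt t (start + b) b

/-- Decoding of the advice with approximation parameter `b`: five selection bits, six approximate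
integers, and two sizes given by `b` fractional bits, which determine a lower and an upper
approximation at distance `1 / 2 ^ b`. -/
def decode (b : ℕ) (t : Tape) : Advice where
  plain := t 0
  part := natAt t 1 2
  variant := natAt t 3 2
  reserved := approxAt b t 5
  good := approxAt b t (5 + 2 * b)
  chunkL := approxAt b t (5 + 4 * b)
  chunkR := approxAt b t (5 + 6 * b)
  black := approxAt b t (5 + 8 * b)
  blackExtra := approxAt b t (5 + 10 * b)
  dUp := ((natAt t (5 + 12 * b) b : ℝ) + 1) / 2 ^ b
  sDown := (natAt t (5 + 13 * b) b : ℝ) / 2 ^ b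
  sUp := ((natAt t (5 + 13 * b) b : ℝ) + 1) / 2 ^ b

/-- Number of bits used by `decode b`. -/
def adviceLength (b : ℕ) : ℕ := 5 + 14 * b

namespace Advice

/-- Number of black reserved bins (at most all the reserved bins). -/
def numBlack (p : Advice) : ℕ := min p.black p.reserved

/-- The 2-items with (zero-based) index in `[fillStart, fillEnd)` are put into reserved bins,
one per bin, after which the largest `declared` of them are declared good. -/
def fillStart (p : Advice) : ℕ :=
  if p.part < 3 then p.part * p.reserved
  else if p.variant < 2 then 3 * p.reserved
  else 3 * p.reserved + p.chunkL

/-- See `fillStart`. -/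
def fillEnd (p : Advice) : ℕ :=
  if p.part < 3 then (p.part + 1) * p.reserved
  else if p.variant = 0 then 3 * p.reserved + p.chunkL + p.chunkR
  else 3 * p.reserved + p.chunkL

/-- From this index on, the 2-items are again put, one per bin, into the remaining reserved bins. -/
def resume (p : Advice) : ℕ∞ :=
  if p.part < 3 then ⊤
  else if p.variant = 0 then ⊤
  else if p.variant = 1 then ((3 * p.reserved + p.chunkL + p.chunkR : ℕ) : ℕ∞)
  else ((3 * p.reserved + p.chunkL : ℕ) : ℕ∞)

/-- The number of 2-items that are declared good. -/
def declared (p : Advice) : ℕ :=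
  if p.part < 3 ∨ p.variant = 0 then p.good - 1 else p.good

end Advice

/-! ### The modified Dual Harmonic strategy -/

/-- Names of bins: the reserved bins, the separate bins for 2-items and those for small items. -/
inductive Bin
  | reserved (i : ℕ)
  | two (i : ℕ)
  | small (i : ℕ)

/-- State of the strategy. -/
structure State where
  /-- number of 2-items seen -/
  twoSeen : ℕ
  /-- entry `i` is the size of the first 2-item put into reserved bin `i` -/
  firsts : List ℝ
  /-- number of reserved bins that have received a second 2-item -/
  matched : ℕ
  /-- Dual Next Fit on the separate bins for 2-items -/
  twoBins : DNF
  /-- Dual Next Fit on the separate bins for small items -/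
  smallBins : DNF
  /-- amount of white items in the reserved bins -/
  white : ℕ → ℝ
  /-- number of black items in black reserved bins -/
  blackUsed : ℕ
  /-- number of those of size in `]sDown, sUp]` -/
  extraUsed : ℕ

/-- The initial state. -/
def State.start : State := ⟨0, [], 0, ⟨0, 0⟩, ⟨0, 0⟩, fun _ => 0, 0, 0⟩

open Classical in
/-- Number of entries of `l` that precede entry `i` in descending order of size, ties being broken
by position. -/
def rank (l : List ℝ) (i : ℕ) : ℕ :=
  ((Finset.range l.length).filter fun j =>
    l.getD i 0 < l.getD j 0 ∨ (l.getD i 0 = l.getD j 0 ∧ j < i)).card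

/-- Positions, in increasing order, of the entries of `l` that are not among the `g` largest. -/
def nonGood (g : ℕ) (l : List ℝ) : List ℕ :=
  (List.range l.length).filter fun i => g ≤ rank l i

/-- Put a small item into a separate bin. -/
def placeSmallSeparate (s : State) (v : ℝ) : Bin × State :=
  (.small s.smallBins.active, { s with smallBins := s.smallBins.insert v })

/-- Put a 2-item into a separate bin; Dual Next Fit packs these items two by two. -/
def placeTwoSeparate (s : State) (v : ℝ) : Bin × State :=
  (.two s.twoBins.active,
    { s with twoSeen := s.twoSeen + 1, twoBins := s.twoBins.insert v })

/-- Placing a black item: the first `numBlack` reserved bins receive one black item each, of size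
at most `sDown`, or, at most `blackExtra` times, of size in `]sDown, sUp]`. -/
def placeBlack (p : Advice) (s : State) (v : ℝ) : Bin × State :=
  if s.blackUsed < p.numBlack ∧ v ≤ p.sDown then
    (.reserved s.blackUsed, { s with blackUsed := s.blackUsed + 1 })
  else if s.blackUsed < p.numBlack ∧ v ≤ p.sUp ∧ s.extraUsed < p.blackExtra then
    (.reserved s.blackUsed,
      { s with blackUsed := s.blackUsed + 1, extraUsed := s.extraUsed + 1 })
  else placeSmallSeparate s v

/-- Placing a white item by Dual Worst Fit: it goes to a white reserved bin with the least amount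
of white items, until all these bins contain at least `dUp` of them. -/
def placeWhite (p : Advice) (s : State) (v : ℝ) : Bin × State :=
  match ((List.range p.reserved).filter fun i => p.numBlack ≤ i).argmin s.white with
  | none => placeSmallSeparate s v
  | some i =>
    if s.white i < p.dUp then
      (.reserved i, { s with white := Function.update s.white i (s.white i + v) })
    else placeSmallSeparate s v

/-- Placing a small item. -/
def placeSmall (p : Advice) (s : State) (v : ℝ) : Bin × State :=
  if p.plain then placeSmallSeparate s v
  else if p.dUp ≤ v then placeBlack p s v
  else placeWhite p s v

/-- Placing a 2-item. -/
def placeTwo (p : Advice) (s : State) (v : ℝ) : Bin × State :=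
  if p.plain then placeTwoSeparate s v
  else if ((p.fillStart ≤ s.twoSeen ∧ s.twoSeen < p.fillEnd) ∨ p.resume ≤ (s.twoSeen : ℕ∞)) ∧
      s.firsts.length < p.reserved then
    (.reserved s.firsts.length,
      { s with twoSeen := s.twoSeen + 1, firsts := s.firsts ++ [v] })
  else if p.fillEnd ≤ s.twoSeen ∧ (s.twoSeen : ℕ∞) < p.resume ∧
      s.matched < (nonGood p.declared s.firsts).length then
    (.reserved ((nonGood p.declared s.firsts).getD s.matched 0),
      { s with twoSeen := s.twoSeen + 1, matched := s.matched + 1 })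
  else placeTwoSeparate s v

/-- One step of the strategy: the bin chosen for the item `v`, and the new state. -/
def step (p : Advice) (s : State) (v : ℝ) : Bin × State :=
  if v < 1 / 2 then placeSmall p s v else placeTwo p s v

/-- The state after serving the items `h`. -/
def stateAfter (p : Advice) (h : List ℝ) : State :=
  h.foldl (fun s v => (step p s v).2) State.start

/-! ### Reading the approximation parameter -/

/-- The tape that starts with the self-delimiting (unary) code `1…10` of `b` and goes on with
`t`. -/
def selfDelimited (b : ℕ) (t : Tape) : Tape :=
  fun i => if i < b then true else if i = b then false else t (i - (b + 1))

/-- The approximation parameter written at the beginning of the tape. -/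
def width (t : Tape) : ℕ := sInf {i | t i = false}

/-- The advice decoded from a tape: first the parameter `b`, then the values. -/
def readAdvice (t : Tape) : Advice := decode (width t) fun i => t (width t + 1 + i)

open Classical in
/-- Number of bits read by `readAdvice`. -/
def readLength (t : Tape) : ℕ∞ :=
  if ∃ i, t i = false then ((width t + 1 + adviceLength (width t) : ℕ) : ℕ∞) else ⊤

theorem natAt_congr {t u : Tape} {start len : ℕ}
    (h : ∀ i, i < start + len → t i = u i) : natAt u start len = natAt t start len := by
  unfold natAt
  refine Finset.sum_congr rfl fun i hi => ?_
  rw [h (start + i) (by have := Finset.mem_range.1 hi; omega)]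

theorem decode_congr {b : ℕ} {t u : Tape} (h : ∀ i, i < adviceLength b → t i = u i) :
    decode b u = decode b t := by
  unfold adviceLength at h
  have hn : ∀ s l, s + l ≤ 5 + 14 * b → natAt u s l = natAt t s l := fun s l hs =>
    natAt_congr fun i hi => h i (by omega)
  have ha : ∀ s, s + 2 * b ≤ 5 + 14 * b → approxAt b u s = approxAt b t s := fun s hs => by
    unfold approxAt
    rw [hn s b (by omega), hn (s + b) b (by omega)]
  unfold decode
  rw [h 0 (by omega), hn 1 2 (by omega), hn 3 2 (by omega), ha 5 (by omega),
    ha (5 + 2 * b) (by omega), ha (5 + 4 * b) (by omega), ha (5 + 6 * b) (by omega),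
    ha (5 + 8 * b) (by omega), ha (5 + 10 * b) (by omega), hn (5 + 12 * b) b (by omega),
    hn (5 + 13 * b) b (by omega)]

theorem width_congr {t u : Tape} (ht : ∃ i, t i = false) (h : ∀ i, i ≤ width t → t i = u i) :
    u (width t) = false ∧ width u = width t := by
  have h0 : t (width t) = false := Nat.sInf_mem (s := {i | t i = false}) ht
  have h1 : u (width t) = false := by rw [← h _ le_rfl]; exact h0
  have h2 : width u ≤ width t := Nat.sInf_le (s := {i | u i = false}) h1
  have h3 : u (width u) = false := Nat.sInf_mem (s := {i | u i = false}) ⟨_, h1⟩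
  have h4 : width t ≤ width u :=
    Nat.sInf_le (s := {i | t i = false}) (by
      change t (width u) = false
      rw [h _ h2]; exact h3)
  exact ⟨h1, le_antisymm h2 h4⟩

theorem read_congr {t u : Tape} (h : ∀ i : ℕ, (i : ℕ∞) < readLength t → t i = u i) :
    readLength u = readLength t ∧ readAdvice u = readAdvice t := by
  by_cases ht : ∃ i, t i = false
  · have h' : ∀ i, i < width t + 1 + adviceLength (width t) → t i = u i := fun i hi => by
      refine h i ?_
      rw [readLength, if_pos ht]
      exact_mod_cast hi
    obtain ⟨h1, h2⟩ := width_congr ht fun i hi => h' i (by omega)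
    constructor
    · rw [readLength, readLength, if_pos ht, if_pos ⟨_, h1⟩, h2]
    · unfold readAdvice
      rw [h2]
      exact decode_congr fun i hi => h' _ (by omega)
  · have hu : t = u := funext fun i => h i (by
      rw [readLength, if_neg ht]
      exact ENat.natCast_lt_top i)
    rw [hu]
    exact ⟨rfl, rfl⟩

/-- The modified Dual Harmonic strategy with two item classes. It reads its advice, beginning with
the number of bits `b` used for the approximations, before the first item is served. -/
def modifiedDualHarmonic : AdviceStrategy Bin where
  place t h v := (step (readAdvice t) (stateAfter (readAdvice t) h) v).1
  bitsRead t _ := readLength t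
  bitsRead_mono _ _ _ := le_rfl
  bitsRead_congr _ _ _ h := (read_congr h).1
  place_congr _ _ _ _ h := by rw [(read_congr h).2]

/-- The number of bits used for the approximations on inputs of length `n`: `2 log log n`,
rounded up. -/
def approxBits (n : ℕ) : ℕ := ⌈2 * Real.logb 2 (Real.logb 2 n)⌉₊

end

end BinCovering

namespace BinCovering

/-!
Give every reserved bin small items of total size `d`. It is then covered by any 2-item of size at
least `θ = 1 - d`, and the other reserved bins get a second 2-item. Since all other 2-items are
packed in pairs, the strategy gains half a bin over `N / 2` for every 2-item that is matched with
small items alone, and small items are wasted only in reserved bins without a 2-item.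

If the optimal packing has `m` bins with one 2-item and `k` bins without, it covers at most
`(N + m) / 2 + k` bins. Let `θ` be such that about `m - 2 r` of the 2-items are large, that is, of
size at least `θ`; then `2 r` of the `m` bins supply small items of size `1 - θ` or more, enough for
`r` reserved bins although the threshold `d` and the split into black and white items are only known
approximately. For `N = m` and in units of `m / 121`, take `r = 27` reserved bins and chunks of
lengths `14`, `13` and `13`, and aim at 14 additional matched 2-items. At least `121 - 54 = 67`
2-items are large. If none of the first three subsequences contains 14 of them, then at least 25 lie
in the chunks of the last one. With `x`, `y` and `z` large items in these three chunks, the failure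
of the cases 2(a), 2(c) and 2(b) means `x + y < 14`, `2 (y + z) - 26 < 14` and `x + 2 z - 13 < 14`;
but then `3 (x + y + z) = 2 (x + y) + (y + z) + (x + 2 z) < 75`.
-/

/-! ### Writing the tape -/

/-- The tape whose first `len` cells hold the number `v`, and which goes on with `t`. -/
def prependNat (len v : ℕ) (t : Tape) : Tape :=
  fun i => if i < len then v.testBit i else t (i - len)

/-- The tape on which numbers, given by their field lengths and values, are written one after the
other. -/
def writeFields (F : List (ℕ × ℕ)) : Tape :=
  F.foldr (fun x t => prependNat x.1 x.2 t) fun _ => false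

theorem natAt_prependNat_zero {len v : ℕ} (hv : v < 2 ^ len) (t : Tape) :
    natAt (prependNat len v t) 0 len = v := by
  have hset : (Finset.range len).filter (v.testBit ·) = v.bitIndices.toFinset := by
    ext i
    simp only [Finset.mem_filter, Finset.mem_range, List.mem_toFinset, Nat.mem_bitIndices,
      and_iff_right_iff_imp]
    exact fun hi =>
      (Nat.pow_lt_pow_iff_right one_lt_two).1 ((Nat.ge_two_pow_of_testBit hi).trans_lt hv)
  refine Eq.trans ?_ (Finset.sum_toFinset_bitIndices_two_pow v)
  rw [natAt, ← hset, Finset.sum_filter]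
  refine Finset.sum_congr rfl fun i hi => ?_
  rw [zero_add, prependNat, if_pos (Finset.mem_range.1 hi)]

theorem natAt_prependNat_add (len v : ℕ) (t : Tape) (start l : ℕ) :
    natAt (prependNat len v t) (len + start) l = natAt t start l := by
  refine Finset.sum_congr rfl fun i _ => ?_
  rw [add_assoc, prependNat, if_neg (Nat.not_lt.2 (Nat.le_add_right _ _)), Nat.add_sub_cancel_left]

theorem natAt_writeFields {F : List (ℕ × ℕ)} (hF : ∀ x ∈ F, x.2 < 2 ^ x.1) {k len v start : ℕ}
    (hk : F[k]? = some (len, v)) (hstart : start = ((F.take k).map Prod.fst).sum) :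
    natAt (writeFields F) start len = v := by
  subst hstart
  induction F generalizing k with
  | nil => simp at hk
  | cons x F ih =>
    cases k with
    | zero =>
      obtain rfl : x = (len, v) := by simpa using hk
      exact natAt_prependNat_zero (hF _ List.mem_cons_self) _
    | succ k =>
      rw [List.take_succ_cons, List.map_cons, List.sum_cons]
      exact (natAt_prependNat_add _ _ _ _ _).trans
        (ih (fun y hy => hF y (List.mem_cons_of_mem _ hy)) (by simpa using hk))

/-- `v` can be written with `b` significant bits and a `b`-bit exponent. -/
def Representable (b v : ℕ) : Prop := ∃ a < 2 ^ b, ∃ e < 2 ^ b, v = a * 2 ^ e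

/-- The advice values that `decode b` reads from some tape: the sizes `dUp` and `sUp` are the upper
ends of dyadic intervals of length `1 / 2 ^ b`, and `sDown` is the lower end belonging to `sUp`. -/
structure Advice.Encodable (b : ℕ) (p : Advice) : Prop where
  part_lt : p.part < 4
  variant_lt : p.variant < 4
  reserved : Representable b p.reserved
  good : Representable b p.good
  chunkL : Representable b p.chunkL
  chunkR : Representable b p.chunkR
  black : Representable b p.black
  blackExtra : Representable b p.blackExtra
  dUp : ∃ x : ℕ, x < 2 ^ b ∧ p.dUp = ((x : ℝ) + 1) / 2 ^ b
  sizes : ∃ y : ℕ, y < 2 ^ b ∧ p.sDown = (y : ℝ) / 2 ^ b ∧ p.sUp = ((y : ℝ) + 1) / 2 ^ b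

theorem approxAt_eq {b start a e : ℕ} {t : Tape} (ha : natAt t start b = a)
    (he : natAt t (start + b) b = e) : approxAt b t start = a * 2 ^ e := by
  rw [approxAt, ha, he]

theorem apply_zero_eq_of_natAt {t : Tape} {c : Bool} (h : natAt t 0 1 = c.toNat) : t 0 = c := by
  cases ht : t 0 <;> cases c <;> simp_all [natAt]

theorem Advice.Encodable.exists_decode_eq {b : ℕ} {p : Advice} (hp : p.Encodable b) :
    ∃ t, decode b t = p := by
  obtain ⟨plain, part, variant, reserved, good, chunkL, chunkR, black, blackExtra, dUp, sDown,
    sUp⟩ := p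
  obtain ⟨hpart, hvariant, ⟨a₁, ha₁, e₁, he₁, h₁⟩, ⟨a₂, ha₂, e₂, he₂, h₂⟩, ⟨a₃, ha₃, e₃, he₃, h₃⟩,
    ⟨a₄, ha₄, e₄, he₄, h₄⟩, ⟨a₅, ha₅, e₅, he₅, h₅⟩, ⟨a₆, ha₆, e₆, he₆, h₆⟩, ⟨x, hx, hd⟩,
    y, hy, hsDown, hsUp⟩ := hp
  dsimp only at hpart hvariant h₁ h₂ h₃ h₄ h₅ h₆ hd hsDown hsUp
  set F : List (ℕ × ℕ) := [(1, plain.toNat), (2, part), (2, variant), (b, a₁), (b, e₁), (b, a₂),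
    (b, e₂), (b, a₃), (b, e₃), (b, a₄), (b, e₄), (b, a₅), (b, e₅), (b, a₆), (b, e₆), (b, x),
    (b, y)] with hFdef
  have hF : ∀ z ∈ F, z.2 < 2 ^ z.1 := by
    simp only [hFdef, List.forall_mem_cons, List.not_mem_nil, false_imp_iff, implies_true]
    have := Bool.toNat_lt plain
    exact ⟨this, hpart, hvariant, ha₁, he₁, ha₂, he₂, ha₃, he₃, ha₄, he₄, ha₅, he₅, ha₆, he₆, hx,
      hy, trivial⟩
  have field {k len v start : ℕ} (hk : F[k]? = some (len, v))
      (hstart : start = ((F.take k).map Prod.fst).sum) : natAt (writeFields F) start len = v :=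
    natAt_writeFields hF hk hstart
  refine ⟨writeFields F, ?_⟩
  rw [decode, apply_zero_eq_of_natAt (field (k := 0) rfl ?_), field (k := 1) rfl ?_,
    field (k := 2) rfl ?_, approxAt_eq (field (k := 3) rfl ?_) (field (k := 4) rfl ?_),
    approxAt_eq (field (k := 5) rfl ?_) (field (k := 6) rfl ?_),
    approxAt_eq (field (k := 7) rfl ?_) (field (k := 8) rfl ?_),
    approxAt_eq (field (k := 9) rfl ?_) (field (k := 10) rfl ?_),
    approxAt_eq (field (k := 11) rfl ?_) (field (k := 12) rfl ?_),
    approxAt_eq (field (k := 13) rfl ?_) (field (k := 14) rfl ?_), field (k := 15) rfl ?_,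
    field (k := 16) rfl ?_, ← h₁, ← h₂, ← h₃, ← h₄, ← h₅, ← h₆, ← hd, ← hsDown, ← hsUp]
  all_goals simp only [hFdef, List.take_succ_cons, List.take_zero, List.map_cons, List.map_nil,
    List.sum_cons, List.sum_nil]
  all_goals ring

/-! ### Reading the approximation parameter -/

theorem width_selfDelimited (b : ℕ) (t : Tape) : width (selfDelimited b t) = b := by
  have hb : selfDelimited b t b = false := by simp [selfDelimited]
  refine le_antisymm (Nat.sInf_le hb) (le_csInf ⟨b, hb⟩ fun i hi => not_lt.1 fun hib => ?_)
  rw [Set.mem_ofPred_eq, selfDelimited, if_pos hib] at hi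
  exact Bool.noConfusion hi

theorem readAdvice_selfDelimited (b : ℕ) (t : Tape) :
    readAdvice (selfDelimited b t) = decode b t := by
  rw [readAdvice, width_selfDelimited]
  congr 1
  funext i
  rw [selfDelimited, if_neg (by omega), if_neg (by omega), Nat.add_sub_cancel_left]

theorem readLength_selfDelimited (b : ℕ) (t : Tape) :
    readLength (selfDelimited b t) = ((15 * b + 6 : ℕ) : ℕ∞) := by
  rw [readLength, if_pos ⟨b, by simp [selfDelimited]⟩, width_selfDelimited, adviceLength]
  congr 1
  ring

/-! ### Contents of the bins -/

open Classical in
/-- Total weight `w` of those items among `h` that the strategy with advice `p` puts into bin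
`j`. -/
noncomputable def weightIn (p : Advice) (w : ℝ → ℝ) (h : List ℝ) (j : Bin) : ℝ :=
  ∑ i ∈ Finset.range h.length,
    if (step p (stateAfter p (h.take i)) (h.getD i 0)).1 = j then w (h.getD i 0) else 0

/-- The weight of an item that counts only the sizes of small items. -/
noncomputable def smallSize (v : ℝ) : ℝ := if v < 1 / 2 then v else 0

/-- The weight of an item that counts only the sizes of 2-items. -/
noncomputable def twoSize (v : ℝ) : ℝ := if v < 1 / 2 then 0 else v

section Weights

variable {p : Advice} {w : ℝ → ℝ} {h : List ℝ} {v : ℝ} {j : Bin}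

theorem stateAfter_append (p : Advice) (h : List ℝ) (v : ℝ) :
    stateAfter p (h ++ [v]) = (step p (stateAfter p h) v).2 := by
  simp [stateAfter]

open Classical in
theorem weightIn_append (p : Advice) (w : ℝ → ℝ) (h : List ℝ) (v : ℝ) (j : Bin) :
    weightIn p w (h ++ [v]) j =
      weightIn p w h j + if (step p (stateAfter p h) v).1 = j then w v else 0 := by
  unfold weightIn
  rw [List.length_append, List.length_singleton, Finset.sum_range_succ]
  congr 1
  · refine Finset.sum_congr rfl fun i hi => ?_
    have hi := Finset.mem_range.1 hi
    rw [List.take_append_of_le_length hi.le, List.getD_append _ _ _ _ hi]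
  · simp

theorem weightIn_le_append (hv : 0 ≤ w v) (j : Bin) :
    weightIn p w h j ≤ weightIn p w (h ++ [v]) j := by
  rw [weightIn_append]
  split_ifs <;> linarith

theorem weightIn_append_self (p : Advice) (w : ℝ → ℝ) (h : List ℝ) (v : ℝ) :
    weightIn p w (h ++ [v]) (step p (stateAfter p h) v).1 =
      weightIn p w h (step p (stateAfter p h) v).1 + w v := by
  rw [weightIn_append, if_pos rfl]

theorem weightIn_append_of_eq_zero (hv : w v = 0) :
    weightIn p w (h ++ [v]) = weightIn p w h := by
  funext j
  rw [weightIn_append, hv, ite_self, add_zero]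

theorem weightIn_nonneg (hw : ∀ v ∈ h, 0 ≤ w v) (j : Bin) : 0 ≤ weightIn p w h j := by
  refine Finset.sum_nonneg fun i hi => ?_
  have hi := Finset.mem_range.1 hi
  split_ifs
  · rw [List.getD_eq_getElem _ _ hi]
    exact hw _ (List.getElem_mem hi)
  · exact le_rfl

theorem weightIn_id (p : Advice) (h : List ℝ) (j : Bin) :
    weightIn p id h j = weightIn p smallSize h j + weightIn p twoSize h j := by
  unfold weightIn
  rw [← Finset.sum_add_distrib]
  refine Finset.sum_congr rfl fun i _ => ?_
  unfold smallSize twoSize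
  split_ifs <;> simp

theorem smallSize_nonneg (hv : 0 < v) : 0 ≤ smallSize v := by
  unfold smallSize
  split_ifs <;> linarith

theorem twoSize_nonneg (hv : 0 < v) : 0 ≤ twoSize v := by
  unfold twoSize
  split_ifs <;> linarith

theorem load_placement (t : Tape) (σ : List ℝ) (j : Bin) :
    load σ (modifiedDualHarmonic.placement t σ) j = weightIn (readAdvice t) id σ j := by
  unfold load weightIn
  rw [Finset.sum_range]
  refine Finset.sum_congr rfl fun i _ => ?_
  rw [List.getD_eq_getElem _ _ i.2]
  rfl

theorem card_le_numCovered {β : Type} {σ : List ℝ} {f : Fin σ.length → β} {S : Finset β}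
    (hS : ∀ j ∈ S, 1 ≤ load σ f j) : S.card ≤ numCovered σ f := by
  classical
  refine Finset.card_le_card fun j hj => Finset.mem_filter.2 ⟨?_, hS j hj⟩
  by_contra hne
  have hload : load σ f j = 0 := Finset.sum_eq_zero fun i _ =>
    if_neg fun h => hne (Finset.mem_image.2 ⟨i, Finset.mem_univ _, h⟩)
  linarith [hS j hj]

theorem card_le_covered {t : Tape} {σ : List ℝ} {S : Finset Bin}
    (hS : ∀ j ∈ S, 1 ≤ weightIn (readAdvice t) id σ j) :
    S.card ≤ modifiedDualHarmonic.covered t σ :=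
  card_le_numCovered fun j hj => (hS j hj).trans_eq (load_placement t σ j).symm

end Weights

/-! ### Dual Next Fit -/

namespace DNF

variable {s : DNF} {L L' : ℕ → ℝ} {v : ℝ} {n : ℕ}

theorem insert_of_le (h : 1 ≤ s.content + v) : s.insert v = ⟨s.active + 1, 0⟩ := if_pos h

theorem insert_of_lt (h : s.content + v < 1) : s.insert v = ⟨s.active, s.content + v⟩ :=
  if_neg (not_le.2 h)

/-- The loads `L` of the bins are at least those recorded by the state `s`, all bins before the
active one being covered. -/
structure Fills (s : DNF) (L : ℕ → ℝ) : Prop where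
  one_le : ∀ i < s.active, 1 ≤ L i
  content_le : s.content ≤ L s.active
  content_nonneg : 0 ≤ s.content
  content_lt : s.content < 1
  nonneg : ∀ i, 0 ≤ L i

theorem Fills.start (hL : ∀ i, 0 ≤ L i) : Fills ⟨0, 0⟩ L where
  one_le _ hi := absurd hi (Nat.not_lt_zero _)
  content_le := hL 0
  content_nonneg := le_rfl
  content_lt := one_pos
  nonneg := hL

theorem Fills.mono (hs : s.Fills L) (hL : ∀ i, L i ≤ L' i) : s.Fills L' where
  one_le i hi := (hs.one_le i hi).trans (hL i)
  content_le := hs.content_le.trans (hL _)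
  content_nonneg := hs.content_nonneg
  content_lt := hs.content_lt
  nonneg i := (hs.nonneg i).trans (hL i)

theorem Fills.insert (hs : s.Fills L) (hL : ∀ i, L i ≤ L' i) (hv : 0 ≤ v)
    (hact : L s.active + v ≤ L' s.active) : (s.insert v).Fills L' := by
  have hs' := hs.mono hL
  have hcontent := hs.content_le
  rcases le_or_gt 1 (s.content + v) with hc | hc
  · rw [insert_of_le hc]
    refine ⟨fun i hi => ?_, hs'.nonneg _, le_rfl, one_pos, hs'.nonneg⟩
    rcases Nat.lt_succ_iff_lt_or_eq.1 hi with hi | rfl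
    · exact hs'.one_le i hi
    · linarith
  · rw [insert_of_lt hc]
    refine ⟨hs'.one_le, ?_, add_nonneg hs.content_nonneg hv, hc, hs'.nonneg⟩
    change s.content + v ≤ L' s.active
    linarith

/-- Covering a bin with items of size at most `1 / 2` uses volume at most `3 / 2`. -/
theorem volume_insert_le (hs : s.content < 1) (hv : v ≤ 1 / 2) :
    3 / 2 * (s.active : ℝ) + s.content + v ≤
      3 / 2 * ((s.insert v).active : ℝ) + (s.insert v).content := by
  rcases le_or_gt 1 (s.content + v) with hc | hc
  · rw [insert_of_le hc]
    push_cast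
    linarith
  · rw [insert_of_lt hc]
    linarith

/-- The state of Dual Next Fit after `n` items of size at least `1 / 2`. -/
def Pairs (s : DNF) (n : ℕ) : Prop :=
  (s.content = 0 ∧ n = 2 * s.active) ∨ (1 / 2 ≤ s.content ∧ n = 2 * s.active + 1)

theorem Pairs.insert (hs : s.Pairs n) (hv : 1 / 2 ≤ v) (hv1 : v < 1) :
    (s.insert v).Pairs (n + 1) := by
  rcases hs with ⟨h0, hn⟩ | ⟨h1, hn⟩
  · rw [insert_of_lt (by linarith)]
    exact Or.inr ⟨hv.trans_eq (by simp [h0]), by rw [hn]⟩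
  · rw [insert_of_le (by linarith)]
    exact Or.inl ⟨rfl, by rw [hn]; ring⟩

theorem Pairs.le_active (hs : s.Pairs n) : n ≤ 2 * s.active + 1 := by
  rcases hs with ⟨-, hn⟩ | ⟨-, hn⟩ <;> omega

end DNF

/-! ### Small items -/

/-- The total size of the small items of `h`. -/
noncomputable def smallVolume (h : List ℝ) : ℝ := (h.map smallSize).sum

/-- The size, truncated at `d`, of an item if it is white, that is, small and of size less than
`D`. -/
noncomputable def whiteSize (D d v : ℝ) : ℝ := if v < 1 / 2 ∧ v < D then min v d else 0

/-- The total size of the white items of `h`, those of size less than `D`, when each of them is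
truncated at `d`. -/
noncomputable def whiteVolume (D d : ℝ) (h : List ℝ) : ℝ := (h.map (whiteSize D d)).sum

open Classical in
/-- The number of black items of `h`, those of size at least `D`, of size at most `s`. -/
noncomputable def blackCount (D s : ℝ) (h : List ℝ) : ℕ :=
  h.countP fun v => v < 1 / 2 ∧ D ≤ v ∧ v ≤ s

/-- The white reserved bins. -/
def Advice.whites (p : Advice) : Finset ℕ := Finset.Ico p.numBlack p.reserved

/-- The loads `L` of the black reserved bins after the items `h`, when `used` of these bins hold
their black item and `extra` of these items are charged to `blackExtra`. -/
structure BlackFilled (p : Advice) (h : List ℝ) (used extra : ℕ) (L : ℕ → ℝ) : Prop where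
  used_le : used ≤ p.numBlack
  extra_le : extra ≤ used
  le_load : ∀ i < used, p.dUp ≤ L i
  count : used = p.numBlack ∨ blackCount p.dUp p.sUp h ≤ used

/-- Dual Worst Fit has put white items, of total size `T` when truncated at `d`, into the bins in
`W`, keeping track of its contents `white` until they reach `D`. A bin below `d` is the witness that
no item was turned away and that no other bin got much more than `2 * d`. -/
structure WhiteFilled (W : Finset ℕ) (D d T : ℝ) (white L : ℕ → ℝ) : Prop where
  le_load : ∀ i ∈ W, white i ≤ L i
  nonneg : ∀ i ∈ W, 0 ≤ white i
  lt : ∀ i ∈ W, white i < 2 * D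
  le_sum : ∀ i ∈ W, white i < d → T ≤ ∑ k ∈ W, min (white k) (2 * d)

/-- What is known about the packing of the small items of `h` when `L` gives the total size of the
small items in each bin. -/
structure SmallInv (p : Advice) (d : ℝ) (h : List ℝ) (L : Bin → ℝ) (s : State) : Prop where
  black : BlackFilled p h s.blackUsed s.extraUsed fun i => L (.reserved i)
  white : WhiteFilled p.whites p.dUp d (whiteVolume p.dUp d h) s.white fun i => L (.reserved i)
  separate : s.smallBins.Fills fun i => L (.small i)
  volume : smallVolume h ≤ 3 / 2 * s.smallBins.active + s.smallBins.content +
    ∑ i ∈ p.whites, s.white i + s.blackUsed * p.sUp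

section SmallItems

variable {p : Advice} {h : List ℝ} {s : State} {D d v : ℝ}

theorem smallVolume_append (h : List ℝ) (v : ℝ) :
    smallVolume (h ++ [v]) = smallVolume h + smallSize v := by
  simp [smallVolume]

theorem whiteVolume_append_of_lt (hv : v < 1 / 2) (hD : v < D) :
    whiteVolume D d (h ++ [v]) = whiteVolume D d h + min v d := by
  simp only [whiteVolume, whiteSize, List.map_append, List.map_cons, List.map_nil, List.sum_append,
    List.sum_singleton, if_pos (And.intro hv hD)]

theorem whiteVolume_append_of_le (hD : D ≤ v) :
    whiteVolume D d (h ++ [v]) = whiteVolume D d h := by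
  simp [whiteVolume, whiteSize, hD.not_gt]

theorem whiteVolume_append_of_two (hv : ¬ v < 1 / 2) :
    whiteVolume D d (h ++ [v]) = whiteVolume D d h := by
  simp only [whiteVolume, whiteSize, List.map_append, List.map_cons, List.map_nil, List.sum_append,
    List.sum_singleton, if_neg fun h : v < 1 / 2 ∧ v < D => hv h.1, add_zero]

theorem blackCount_append_le {S : ℝ} :
    blackCount D S (h ++ [v]) ≤ blackCount D S h + 1 := by
  simp only [blackCount, List.countP_append, List.countP_singleton]
  split_ifs <;> omega

theorem blackCount_append_of_not {S : ℝ} (hv : ¬ (v < 1 / 2 ∧ D ≤ v ∧ v ≤ S)) :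
    blackCount D S (h ++ [v]) = blackCount D S h := by
  simp only [blackCount, List.countP_append, List.countP_singleton, decide_eq_true_eq, if_neg hv,
    add_zero]

section BlackFilled

variable {used extra extra' : ℕ} {L L' : ℕ → ℝ}

theorem BlackFilled.append (hb : BlackFilled p h used extra L) (hL : ∀ i, L i ≤ L' i)
    (hv : v < 1 / 2 → p.dUp ≤ v → v ≤ p.sUp → used = p.numBlack) :
    BlackFilled p (h ++ [v]) used extra L' where
  used_le := hb.used_le
  extra_le := hb.extra_le
  le_load i hi := (hb.le_load i hi).trans (hL i)
  count := by
    by_cases hblack : v < 1 / 2 ∧ p.dUp ≤ v ∧ v ≤ p.sUp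
    · exact Or.inl (hv hblack.1 hblack.2.1 hblack.2.2)
    · rw [blackCount_append_of_not hblack]
      exact hb.count

theorem BlackFilled.append_black (hb : BlackFilled p h used extra L) (hL : ∀ i, L i ≤ L' i)
    (hlt : used < p.numBlack) (hextra : extra' ≤ extra + 1) (hload : p.dUp ≤ L' used) :
    BlackFilled p (h ++ [v]) (used + 1) extra' L' where
  used_le := hlt
  extra_le := hextra.trans (Nat.succ_le_succ hb.extra_le)
  le_load i hi := by
    rcases Nat.lt_succ_iff_lt_or_eq.1 hi with hi | rfl
    · exact (hb.le_load i hi).trans (hL i)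
    · exact hload
  count := Or.inr (blackCount_append_le.trans
    (Nat.succ_le_succ (hb.count.resolve_left hlt.ne)))

theorem BlackFilled.used_eq (hb : BlackFilled p h used extra L)
    (hcount : p.numBlack ≤ blackCount p.dUp p.sUp h) : used = p.numBlack := by
  have := hb.used_le
  rcases hb.count with h | h <;> omega

end BlackFilled

section WhiteFilled

variable {W : Finset ℕ} {T : ℝ} {white L L' : ℕ → ℝ} {i : ℕ}

theorem WhiteFilled.mono (hw : WhiteFilled W D d T white L) (hL : ∀ i, L i ≤ L' i) :
    WhiteFilled W D d T white L' where
  le_load i hi := (hw.le_load i hi).trans (hL i)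
  nonneg := hw.nonneg
  lt := hw.lt
  le_sum := hw.le_sum

theorem WhiteFilled.of_forall_le {T' : ℝ} (hw : WhiteFilled W D d T white L)
    (hfull : ∀ i ∈ W, d ≤ white i) : WhiteFilled W D d T' white L where
  le_load := hw.le_load
  nonneg := hw.nonneg
  lt := hw.lt
  le_sum i hi hlt := absurd hlt (hfull i hi).not_gt

theorem sum_update_add (white : ℕ → ℝ) (hi : i ∈ W) (v : ℝ) :
    ∑ k ∈ W, Function.update white i (white i + v) k = ∑ k ∈ W, white k + v := by
  rw [Finset.sum_update_of_mem hi, ← Finset.add_sum_erase W white hi,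
    Finset.sdiff_singleton_eq_erase]
  ring

theorem WhiteFilled.update (hw : WhiteFilled W D d T white L) (hL : ∀ i, L i ≤ L' i) (hi : i ∈ W)
    (hmin : ∀ k ∈ W, white i ≤ white k) (hlt : white i < D) (hv : 0 < v) (hvD : v < D)
    (hload : L i + v ≤ L' i) :
    WhiteFilled W D d (T + min v d) (Function.update white i (white i + v)) L' := by
  have hle (k : ℕ) : white k ≤ Function.update white i (white i + v) k := by
    rcases eq_or_ne k i with rfl | hk
    · rw [Function.update_self]
      linarith
    · rw [Function.update_of_ne hk]
  refine ⟨fun k hk => ?_, fun k hk => (hw.nonneg k hk).trans (hle k), fun k hk => ?_,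
    fun k hk hkd => ?_⟩
  · rcases eq_or_ne k i with rfl | hki
    · rw [Function.update_self]
      linarith [hw.le_load k hk]
    · rw [Function.update_of_ne hki]
      exact (hw.le_load k hk).trans (hL k)
  · rcases eq_or_ne k i with rfl | hki
    · rw [Function.update_self]
      linarith
    · rw [Function.update_of_ne hki]
      exact hw.lt k hk
  · have hid : white i < d := (hmin k hk).trans_lt ((hle k).trans_lt hkd)
    have hT := hw.le_sum i hi hid
    have hself : min (white i) (2 * d) + min v d ≤ min (white i + v) (2 * d) :=
      le_min (add_le_add (min_le_left _ _) (min_le_left _ _))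
        (by linarith [min_le_left (white i) (2 * d), min_le_right v d])
    have hrest : ∑ k ∈ W.erase i, min (Function.update white i (white i + v) k) (2 * d) =
        ∑ k ∈ W.erase i, min (white k) (2 * d) :=
      Finset.sum_congr rfl fun k hk => by rw [Function.update_of_ne (Finset.ne_of_mem_erase hk)]
    rw [← Finset.add_sum_erase W _ hi, hrest, Function.update_self]
    rw [← Finset.add_sum_erase W _ hi] at hT
    linarith

/-- A bin that stayed below `d` would bound the truncated volume by less than `2 * d` per bin. -/
theorem WhiteFilled.le_of_le (hw : WhiteFilled W D d T white L) (hT : 2 * (W.card : ℝ) * d ≤ T)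
    (hi : i ∈ W) : d ≤ L i := by
  refine le_trans (not_lt.1 fun hlt => ?_) (hw.le_load i hi)
  have hsum : ∑ k ∈ W, min (white k) (2 * d) < ∑ _k ∈ W, 2 * d :=
    Finset.sum_lt_sum (fun _ _ => min_le_right _ _)
      ⟨i, hi, (min_le_left _ _).trans_lt (by linarith [hw.nonneg i hi])⟩
  rw [Finset.sum_const, nsmul_eq_mul] at hsum
  linarith [hw.le_sum i hi hlt]

end WhiteFilled

section SmallInv

variable {L L' : Bin → ℝ}

theorem SmallInv.start (hd : 0 < p.dUp) (hL : ∀ j, 0 ≤ L j) :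
    SmallInv p d [] L State.start where
  black := ⟨Nat.zero_le _, le_rfl, fun _ hi => absurd hi (Nat.not_lt_zero _), Or.inr le_rfl⟩
  white := by
    refine ⟨fun i _ => hL _, fun _ _ => le_rfl, fun _ _ => mul_pos two_pos hd, fun i _ hid => ?_⟩
    exact Finset.sum_nonneg fun _ _ => le_min le_rfl (mul_nonneg zero_le_two hid.le)
  separate := DNF.Fills.start fun i => hL _
  volume := by simp [State.start, smallVolume]

theorem SmallInv.append_two (inv : SmallInv p d h L s) (hv : ¬ v < 1 / 2) {s' : State}
    (hused : s'.blackUsed = s.blackUsed) (hextra : s'.extraUsed = s.extraUsed)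
    (hwhite : s'.white = s.white) (hbins : s'.smallBins = s.smallBins) :
    SmallInv p d (h ++ [v]) L s' where
  black := by
    rw [hused, hextra]
    exact inv.black.append (fun _ => le_rfl) fun hv' => absurd hv' hv
  white := by
    rw [hwhite, whiteVolume_append_of_two hv]
    exact inv.white
  separate := hbins ▸ inv.separate
  volume := by
    rw [smallVolume_append, smallSize, if_neg hv, add_zero, hused, hwhite, hbins]
    exact inv.volume

theorem SmallInv.append_separate (inv : SmallInv p d h L s) (hL : ∀ j, L j ≤ L' j) (h0 : 0 < v)
    (hv : v < 1 / 2) (hload : L (.small s.smallBins.active) + v ≤ L' (.small s.smallBins.active))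
    (hblack : p.dUp ≤ v → v ≤ p.sUp → s.blackUsed = p.numBlack)
    (hwhite : v < p.dUp → ∀ i ∈ p.whites, d ≤ s.white i) :
    SmallInv p d (h ++ [v]) L' (placeSmallSeparate s v).2 where
  black := inv.black.append (fun _ => hL _) fun _ => hblack
  white := by
    have hw := inv.white.mono fun _ => hL _
    rcases lt_or_ge v p.dUp with hd | hd
    · exact hw.of_forall_le (hwhite hd)
    · rw [whiteVolume_append_of_le hd]
      exact hw
  separate := inv.separate.insert (fun _ => hL _) h0.le hload
  volume := by
    have hvol := inv.volume
    have hins := DNF.volume_insert_le inv.separate.content_lt hv.le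
    rw [smallVolume_append, smallSize, if_pos hv]
    change _ ≤ 3 / 2 * ((s.smallBins.insert v).active : ℝ) + (s.smallBins.insert v).content +
      ∑ i ∈ p.whites, s.white i + s.blackUsed * p.sUp
    linarith

theorem SmallInv.append_black (inv : SmallInv p d h L s) (hL : ∀ j, L j ≤ L' j) (hv : v < 1 / 2)
    (hload : L (.reserved s.blackUsed) + v ≤ L' (.reserved s.blackUsed))
    (hL0 : 0 ≤ L (.reserved s.blackUsed)) (hlt : s.blackUsed < p.numBlack) (hd : p.dUp ≤ v)
    (hs : v ≤ p.sUp) {e : ℕ} (he : e ≤ s.extraUsed + 1) :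
    SmallInv p d (h ++ [v]) L' { s with blackUsed := s.blackUsed + 1, extraUsed := e } where
  black := inv.black.append_black (fun _ => hL _) hlt he (by linarith)
  white := by
    rw [whiteVolume_append_of_le hd]
    exact inv.white.mono fun _ => hL _
  separate := inv.separate.mono fun _ => hL _
  volume := by
    rw [smallVolume_append, smallSize, if_pos hv]
    push_cast
    linarith [inv.volume]

theorem SmallInv.append_white (inv : SmallInv p d h L s) (hL : ∀ j, L j ≤ L' j) (h0 : 0 < v)
    (hv : v < 1 / 2) {i : ℕ} (hload : L (.reserved i) + v ≤ L' (.reserved i)) (hd : v < p.dUp)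
    (hi : i ∈ p.whites) (hmin : ∀ k ∈ p.whites, s.white i ≤ s.white k)
    (hlt : s.white i < p.dUp) :
    SmallInv p d (h ++ [v]) L'
      { s with white := Function.update s.white i (s.white i + v) } where
  black := inv.black.append (fun _ => hL _) fun _ hd' => absurd hd hd'.not_gt
  white := by
    rw [whiteVolume_append_of_lt hv hd]
    exact inv.white.update (fun _ => hL _) hi hmin hlt h0 hd hload
  separate := inv.separate.mono fun _ => hL _
  volume := by
    rw [smallVolume_append, smallSize, if_pos hv, sum_update_add _ hi]
    linarith [inv.volume]

theorem placeBlack_cases (p : Advice) (s : State) (v : ℝ) (hs : p.sDown ≤ p.sUp) :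
    (s.blackUsed < p.numBlack ∧ v ≤ p.sUp ∧ ∃ e ≤ s.extraUsed + 1, placeBlack p s v =
      (.reserved s.blackUsed, { s with blackUsed := s.blackUsed + 1, extraUsed := e })) ∨
    (placeBlack p s v = placeSmallSeparate s v ∧
      (s.blackUsed < p.numBlack → v ≤ p.sUp → p.blackExtra ≤ s.extraUsed)) := by
  unfold placeBlack
  split_ifs with hdown hup
  · exact Or.inl ⟨hdown.1, hdown.2.trans hs, _, Nat.le_succ _, rfl⟩
  · exact Or.inl ⟨hup.1, hup.2.1, _, le_rfl, rfl⟩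
  · exact Or.inr ⟨rfl, fun hlt hv => not_lt.1 fun hextra => hup ⟨hlt, hv, hextra⟩⟩

theorem placeWhite_cases (p : Advice) (s : State) (v : ℝ) :
    (∃ i ∈ p.whites, (∀ k ∈ p.whites, s.white i ≤ s.white k) ∧ s.white i < p.dUp ∧
      placeWhite p s v =
        (.reserved i, { s with white := Function.update s.white i (s.white i + v) })) ∨
    (placeWhite p s v = placeSmallSeparate s v ∧ ∀ i ∈ p.whites, p.dUp ≤ s.white i) := by
  have hmem (i : ℕ) : i ∈ (List.range p.reserved).filter (fun i => p.numBlack ≤ i) ↔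
      i ∈ p.whites := by
    simp [Advice.whites, and_comm]
  unfold placeWhite
  rcases h : ((List.range p.reserved).filter fun i => p.numBlack ≤ i).argmin s.white with _ | i
  · rw [List.argmin_eq_none] at h
    exact Or.inr ⟨rfl, fun i hi => by simp [← hmem, h] at hi⟩
  · have hmin : ∀ k ∈ p.whites, s.white i ≤ s.white k := fun k hk =>
      List.le_of_mem_argmin ((hmem k).2 hk) h
    by_cases hd : s.white i < p.dUp
    · exact Or.inl ⟨i, (hmem i).1 (List.argmin_mem h), hmin, hd, if_pos hd⟩
    · exact Or.inr ⟨if_neg hd, fun k hk => (not_lt.1 hd).trans (hmin k hk)⟩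

theorem SmallInv.placeSmall (inv : SmallInv p d h L s) (hp : p.plain = false) (hd : d ≤ p.dUp)
    (hs : p.sDown ≤ p.sUp) (hextra : p.numBlack ≤ p.blackExtra) (h0 : 0 < v) (hv : v < 1 / 2)
    (hL0 : ∀ j, 0 ≤ L j) (hL : ∀ j, L j ≤ L' j)
    (hload : L (placeSmall p s v).1 + v ≤ L' (placeSmall p s v).1) :
    SmallInv p d (h ++ [v]) L' (placeSmall p s v).2 := by
  rw [BinCovering.placeSmall, if_neg (by simp [hp])] at hload ⊢
  split_ifs at hload ⊢ with hb
  · rcases placeBlack_cases p s v hs with ⟨hlt, hvs, e, he, hstep⟩ | ⟨hstep, hfull⟩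
    · rw [hstep] at hload ⊢
      exact inv.append_black hL hv hload (hL0 _) hlt hb hvs he
    · rw [hstep] at hload ⊢
      refine inv.append_separate hL h0 hv hload (fun _ hvs => ?_) fun hd' => absurd hb hd'.not_ge
      refine inv.black.used_le.antisymm (not_lt.1 fun hlt => ?_)
      have := hfull hlt hvs
      have := inv.black.extra_le
      omega
  · rcases placeWhite_cases p s v with ⟨i, hi, hmin, hlt, hstep⟩ | ⟨hstep, hfull⟩
    · rw [hstep] at hload ⊢
      exact inv.append_white hL h0 hv hload (not_le.1 hb) hi hmin hlt
    · rw [hstep] at hload ⊢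
      exact inv.append_separate hL h0 hv hload (fun hb' => absurd hb' hb) fun _ i hi =>
        hd.trans (hfull i hi)

theorem placeTwo_small (p : Advice) (s : State) (v : ℝ) :
    (placeTwo p s v).2.blackUsed = s.blackUsed ∧ (placeTwo p s v).2.extraUsed = s.extraUsed ∧
    (placeTwo p s v).2.white = s.white ∧ (placeTwo p s v).2.smallBins = s.smallBins := by
  unfold placeTwo placeTwoSeparate
  split_ifs <;> simp

theorem smallInv_stateAfter (hp : p.plain = false) (hd0 : 0 < p.dUp) (hd : d ≤ p.dUp)
    (hs : p.sDown ≤ p.sUp) (hextra : p.numBlack ≤ p.blackExtra) (h : List ℝ) (hh : IsInput h) :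
    SmallInv p d h (weightIn p smallSize h) (stateAfter p h) := by
  induction h using List.reverseRecOn with
  | nil => exact SmallInv.start hd0 (weightIn_nonneg (by simp))
  | append_singleton h v ih =>
    have hh' : IsInput h := fun x hx => hh x (List.mem_append_left _ hx)
    have h0 : 0 < v := (hh v (by simp)).1
    have hload := weightIn_append_self p smallSize h v
    rw [stateAfter_append]
    by_cases hv : v < 1 / 2
    · have hstep : step p (stateAfter p h) v = placeSmall p (stateAfter p h) v := if_pos hv
      rw [hstep] at hload ⊢
      refine (ih hh').placeSmall hp hd hs hextra h0 hv
        (weightIn_nonneg fun x hx => smallSize_nonneg (hh' x hx).1)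
        (weightIn_le_append (smallSize_nonneg h0)) ?_
      rw [hload, smallSize, if_pos hv]
    · have hstep : step p (stateAfter p h) v = placeTwo p (stateAfter p h) v := if_neg hv
      obtain ⟨hused, hextra', hwhite, hbins⟩ := placeTwo_small p (stateAfter p h) v
      rw [hstep, weightIn_append_of_eq_zero (w := smallSize) (if_neg hv)]
      exact (ih hh').append_two hv hused hextra' hwhite hbins

theorem Advice.card_whites (p : Advice) : (p.whites.card : ℝ) = p.reserved - p.numBlack := by
  rw [Advice.whites, Nat.card_Ico,
    Nat.cast_sub (show p.numBlack ≤ p.reserved from min_le_right _ _)]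

theorem SmallInv.le_load (inv : SmallInv p d h L s) (hd : d ≤ p.dUp)
    (hb : p.numBlack ≤ blackCount p.dUp p.sUp h)
    (hw : 2 * ((p.reserved : ℝ) - p.numBlack) * d ≤ whiteVolume p.dUp d h) {i : ℕ}
    (hi : i < p.reserved) : d ≤ L (.reserved i) := by
  by_cases hib : i < p.numBlack
  · exact hd.trans (inv.black.le_load i (inv.black.used_eq hb ▸ hib))
  · exact inv.white.le_of_le (by rwa [p.card_whites]) (Finset.mem_Ico.2 ⟨not_lt.1 hib, hi⟩)

theorem SmallInv.le_active (inv : SmallInv p d h L s) (hs : 0 ≤ p.sUp) :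
    2 / 3 * (smallVolume h - 2 * (p.reserved - p.numBlack) * p.dUp - p.numBlack * p.sUp - 1) ≤
      (s.smallBins.active : ℝ) := by
  have hwhite : ∑ i ∈ p.whites, s.white i ≤ ∑ _i ∈ p.whites, 2 * p.dUp :=
    Finset.sum_le_sum fun i hi => (inv.white.lt i hi).le
  rw [Finset.sum_const, nsmul_eq_mul, p.card_whites] at hwhite
  have hblack : (s.blackUsed : ℝ) * p.sUp ≤ p.numBlack * p.sUp :=
    mul_le_mul_of_nonneg_right (by exact_mod_cast inv.black.used_le) hs
  linarith [inv.volume, inv.separate.content_lt]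

end SmallInv

end SmallItems

/-! ### Items of size at least `1 / 2` -/

/-- The 2-items of `h`. -/
noncomputable def twos (h : List ℝ) : List ℝ := h.filter fun v => ¬ v < 1 / 2

/-- The advice `p` makes the first `N` 2-items go through these phases: those with index in `[a, e)`
are put singly into reserved bins, those with index in `[e, T)` complete reserved bins, and those
from index `T` on are again put singly into reserved bins. -/
structure Advice.Schedule (p : Advice) (N a e T : ℕ) : Prop where
  fillStart : p.fillStart = a
  fillEnd : p.fillEnd = e
  resume_le_iff : ∀ n < N, p.resume ≤ (n : ℕ∞) ↔ T ≤ n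
  start_le : a ≤ e
  end_le : e ≤ T
  le_reserved : e - a ≤ p.reserved

/-- The 2-items among `u` with index in `[a, e)`. -/
def window (a e : ℕ) (u : List ℝ) : List ℝ := (u.take e).drop a

/-- The 2-items among `u` that come first into their reserved bin, when there are `r` reserved bins
and the phases are separated by the indices `a`, `e` and `T`. -/
def firstItems (r a e T : ℕ) (u : List ℝ) : List ℝ :=
  window a e u ++ (u.drop T).take (r - (e - a))

/-- The number of reserved bins with two 2-items after `n` 2-items, when `k` bins are to be
completed from index `e` to index `T`. -/
def numMatched (n e T k : ℕ) : ℕ := min (min n T - e) k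

/-- What is known about the packing of the first `n` 2-items when `L` gives the total size of the
2-items in each bin: those in `F` came first into reserved bins, `m` of them completed the reserved
bins listed in `B`, and the others were packed in pairs. -/
structure TwoInv (n : ℕ) (F : List ℝ) (B : List ℕ) (m : ℕ) (L : Bin → ℝ) (s : State) : Prop where
  seen : s.twoSeen = n
  firsts : s.firsts = F
  matched : s.matched = m
  half_le : ∀ x ∈ F, 1 / 2 ≤ x
  le_load : ∀ i < F.length, F.getD i 0 ≤ L (.reserved i)
  one_le_load : ∀ q < m, 1 ≤ L (.reserved (B.getD q 0))
  separate : s.twoBins.Fills fun i => L (.two i)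
  count : ∃ k, s.twoBins.Pairs k ∧ n = F.length + m + k

section TwoItems

variable {p : Advice} {h u F : List ℝ} {s : State} {v : ℝ} {B : List ℕ} {L L' : Bin → ℝ}
  {n m N a e T r : ℕ}

theorem twos_append_of_lt (hv : v < 1 / 2) : twos (h ++ [v]) = twos h := by
  simp only [twos, List.filter_append, List.filter_singleton, hv, not_true_eq_false, decide_false,
    cond_false, List.append_nil]

theorem twos_append_of_not_lt (hv : ¬ v < 1 / 2) : twos (h ++ [v]) = twos h ++ [v] := by
  simp only [twos, List.filter_append, List.filter_singleton, hv, not_false_eq_true, decide_true,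
    cond_true]

theorem mem_nonGood {g i : ℕ} {l : List ℝ} : i ∈ nonGood g l ↔ i < l.length ∧ g ≤ rank l i := by
  simp [nonGood]

theorem placeSmall_two (p : Advice) (s : State) (v : ℝ) :
    (placeSmall p s v).2.twoSeen = s.twoSeen ∧ (placeSmall p s v).2.firsts = s.firsts ∧
    (placeSmall p s v).2.matched = s.matched ∧ (placeSmall p s v).2.twoBins = s.twoBins := by
  unfold placeSmall placeBlack placeWhite placeSmallSeparate
  split_ifs <;> [simp; simp; simp; simp; skip]
  split <;> [simp; (split_ifs <;> simp)]

section TwoInv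

theorem TwoInv.congr_state {s' : State} (inv : TwoInv n F B m L s)
    (hseen : s'.twoSeen = s.twoSeen) (hfirsts : s'.firsts = s.firsts)
    (hmatched : s'.matched = s.matched) (hbins : s'.twoBins = s.twoBins) :
    TwoInv n F B m L s' where
  seen := hseen.trans inv.seen
  firsts := hfirsts.trans inv.firsts
  matched := hmatched.trans inv.matched
  half_le := inv.half_le
  le_load := inv.le_load
  one_le_load := inv.one_le_load
  separate := hbins ▸ inv.separate
  count := hbins ▸ inv.count

theorem TwoInv.congr_bins (inv : TwoInv n F B 0 L s) (B' : List ℕ) : TwoInv n F B' 0 L s :=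
  { inv with one_le_load := fun _ hq => absurd hq (Nat.not_lt_zero _) }

theorem TwoInv.append_separate (inv : TwoInv n F B m L s) (hL : ∀ j, L j ≤ L' j)
    (hv : 1 / 2 ≤ v) (hv1 : v < 1)
    (hload : L (.two s.twoBins.active) + v ≤ L' (.two s.twoBins.active)) :
    TwoInv (n + 1) F B m L' (placeTwoSeparate s v).2 where
  seen := congrArg Nat.succ inv.seen
  firsts := inv.firsts
  matched := inv.matched
  half_le := inv.half_le
  le_load i hi := (inv.le_load i hi).trans (hL _)
  one_le_load q hq := (inv.one_le_load q hq).trans (hL _)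
  separate := inv.separate.insert (fun _ => hL _) (by linarith) hload
  count := by
    obtain ⟨k, hk, hn⟩ := inv.count
    exact ⟨k + 1, hk.insert hv hv1, by omega⟩

theorem TwoInv.append_first (inv : TwoInv n F B m L s) (hL : ∀ j, L j ≤ L' j)
    (hL0 : ∀ j, 0 ≤ L j) (hv : 1 / 2 ≤ v)
    (hload : L (.reserved s.firsts.length) + v ≤ L' (.reserved s.firsts.length)) :
    TwoInv (n + 1) (F ++ [v]) B m L'
      { s with twoSeen := s.twoSeen + 1, firsts := s.firsts ++ [v] } where
  seen := congrArg Nat.succ inv.seen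
  firsts := congrArg (· ++ [v]) inv.firsts
  matched := inv.matched
  half_le x hx := by
    rcases List.mem_append.1 hx with hx | hx
    · exact inv.half_le x hx
    · rwa [List.mem_singleton.1 hx]
  le_load i hi := by
    rw [List.length_append, List.length_singleton] at hi
    rcases Nat.lt_succ_iff_lt_or_eq.1 hi with hi | rfl
    · rw [List.getD_append _ _ _ _ hi]
      exact (inv.le_load i hi).trans (hL _)
    · rw [inv.firsts] at hload
      rw [List.getD_append_right _ _ _ _ le_rfl, Nat.sub_self, List.getD_cons_zero]
      linarith [hL0 (.reserved F.length)]
  one_le_load q hq := (inv.one_le_load q hq).trans (hL _)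
  separate := inv.separate.mono fun _ => hL _
  count := by
    obtain ⟨k, hk, hn⟩ := inv.count
    exact ⟨k, hk, by rw [List.length_append, List.length_singleton]; omega⟩

theorem TwoInv.append_matched (inv : TwoInv n F B m L s) (hL : ∀ j, L j ≤ L' j)
    (hv : 1 / 2 ≤ v) (hB : B.getD m 0 < F.length)
    (hload : L (.reserved (B.getD m 0)) + v ≤ L' (.reserved (B.getD m 0))) :
    TwoInv (n + 1) F B (m + 1) L'
      { s with twoSeen := s.twoSeen + 1, matched := s.matched + 1 } where
  seen := congrArg Nat.succ inv.seen
  firsts := inv.firsts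
  matched := congrArg Nat.succ inv.matched
  half_le := inv.half_le
  le_load i hi := (inv.le_load i hi).trans (hL _)
  one_le_load q hq := by
    rcases Nat.lt_succ_iff_lt_or_eq.1 hq with hq | rfl
    · exact (inv.one_le_load q hq).trans (hL _)
    · have hfirst := inv.le_load _ hB
      have hhalf := inv.half_le _ (List.getElem_mem hB)
      rw [List.getD_eq_getElem _ _ hB] at hfirst
      linarith
  separate := inv.separate.mono fun _ => hL _
  count := by
    obtain ⟨k, hk, hn⟩ := inv.count
    exact ⟨k, hk, by omega⟩

end TwoInv

section Schedule

theorem Advice.Schedule.placeTwo_eq (S : p.Schedule N a e T) (hp : p.plain = false)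
    (hn : s.twoSeen < N) (v : ℝ) : placeTwo p s v =
      if ((a ≤ s.twoSeen ∧ s.twoSeen < e) ∨ T ≤ s.twoSeen) ∧ s.firsts.length < p.reserved then
        (.reserved s.firsts.length,
          { s with twoSeen := s.twoSeen + 1, firsts := s.firsts ++ [v] })
      else if e ≤ s.twoSeen ∧ s.twoSeen < T ∧
          s.matched < (nonGood p.declared s.firsts).length then
        (.reserved ((nonGood p.declared s.firsts).getD s.matched 0),
          { s with twoSeen := s.twoSeen + 1, matched := s.matched + 1 })
      else placeTwoSeparate s v := by
  have hresume : (s.twoSeen : ℕ∞) < p.resume ↔ s.twoSeen < T := by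
    rw [← not_le, S.resume_le_iff _ hn, not_le]
  simp only [placeTwo, hp, Bool.false_eq_true, if_false, S.fillStart, S.fillEnd,
    S.resume_le_iff _ hn, hresume]

theorem length_window (u : List ℝ) : (window a e u).length = min e u.length - a := by
  rw [window, List.length_drop, List.length_take]

theorem length_firstItems (u : List ℝ) : (firstItems r a e T u).length =
    min e u.length - a + min (r - (e - a)) (u.length - T) := by
  rw [firstItems, List.length_append, length_window, List.length_take, List.length_drop]

theorem window_append_of_le (hn : e ≤ u.length) : window a e (u ++ [v]) = window a e u := by
  rw [window, window, List.take_append_of_le_length hn]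

theorem firstItems_append_of_window_eq (h : window a e (u ++ [v]) = window a e u)
    (hn : u.length < T ∨ r - (e - a) ≤ u.length - T) :
    firstItems r a e T (u ++ [v]) = firstItems r a e T u := by
  rw [firstItems, firstItems, h]
  rcases hn with hn | hn
  · rw [List.drop_eq_nil_of_le (by simpa using hn), List.drop_eq_nil_of_le hn.le]
  · rcases le_total T u.length with hT | hT
    · rw [List.drop_append_of_le_length hT, List.take_append_of_le_length (by simpa using hn)]
    · rw [show r - (e - a) = 0 by omega, List.take_zero, List.take_zero]

theorem window_append_of_lt (hn : u.length < a) : window a e (u ++ [v]) = window a e u := by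
  rw [window, window, List.drop_eq_nil_of_le ((List.length_take_le' _ _).trans (by simpa using hn)),
    List.drop_eq_nil_of_le ((List.length_take_le' _ _).trans hn.le)]

theorem firstItems_append_of_mem_window (ha : a ≤ u.length) (he : u.length < e) (heT : e ≤ T) :
    firstItems r a e T (u ++ [v]) = firstItems r a e T u ++ [v] := by
  have hT : u.length + 1 ≤ T := Nat.lt_of_lt_of_le he heT
  have hdrop : u.drop T = [] := List.drop_eq_nil_of_le (Nat.le_of_succ_le hT)
  have hdrop' : (u ++ [v]).drop T = [] := List.drop_eq_nil_of_le (by simpa using hT)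
  rw [firstItems, firstItems, window, window, hdrop, hdrop', List.take_nil, List.append_nil,
    List.append_nil, List.take_of_length_le (by simpa using he), List.take_of_length_le he.le,
    List.drop_append_of_le_length ha]

theorem firstItems_append_of_resumed (he : e ≤ u.length) (hT : T ≤ u.length)
    (hr : u.length - T < r - (e - a)) :
    firstItems r a e T (u ++ [v]) = firstItems r a e T u ++ [v] := by
  rw [firstItems, firstItems, window_append_of_le he, List.drop_append_of_le_length hT,
    List.take_of_length_le (by simp; omega), List.take_of_length_le (by simp; omega),
    List.append_assoc]

/-- `TwoInv` for the items that `Advice.Schedule` prescribes. -/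
def ScheduledInv (p : Advice) (a e T : ℕ) (u : List ℝ) (L : Bin → ℝ) (s : State) : Prop :=
  TwoInv u.length (firstItems p.reserved a e T u) (nonGood p.declared (window a e u))
    (numMatched u.length e T (nonGood p.declared (window a e u)).length) L s

theorem ScheduledInv.placeTwo_of_lt (inv : ScheduledInv p a e T u L s) (S : p.Schedule N a e T)
    (hp : p.plain = false) (hN : u.length < N) (hne : u.length < e) (hv : 1 / 2 ≤ v) (hv1 : v < 1)
    (hL0 : ∀ j, 0 ≤ L j) (hL : ∀ j, L j ≤ L' j)
    (hload : L (placeTwo p s v).1 + v ≤ L' (placeTwo p s v).1) :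
    ScheduledInv p a e T (u ++ [v]) L' (placeTwo p s v).2 := by
  have hseen := inv.seen
  have hfirsts := congrArg List.length inv.firsts
  have hle := S.le_reserved
  have heT := S.end_le
  have hzero (k : ℕ) {n : ℕ} (hn : n ≤ e) : numMatched n e T k = 0 := by
    rw [numMatched]
    omega
  rw [length_firstItems] at hfirsts
  rw [ScheduledInv, hzero _ hne.le] at inv
  rw [S.placeTwo_eq hp (hseen ▸ hN)] at hload ⊢
  rw [ScheduledInv, List.length_append, List.length_singleton, hzero _ hne]
  rcases lt_or_ge u.length a with hna | hna
  · rw [if_neg (by omega), if_neg (by omega)] at hload ⊢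
    rw [window_append_of_lt hna, firstItems_append_of_window_eq (window_append_of_lt hna)
      (Or.inl (by omega))]
    exact inv.append_separate hL hv hv1 hload
  · rw [if_pos (by omega)] at hload ⊢
    rw [firstItems_append_of_mem_window hna hne heT]
    exact (inv.append_first hL hL0 hv hload).congr_bins _

theorem ScheduledInv.placeTwo_of_le_of_lt (inv : ScheduledInv p a e T u L s)
    (S : p.Schedule N a e T) (hp : p.plain = false) (hN : u.length < N) (hen : e ≤ u.length)
    (hnT : u.length < T) (hv : 1 / 2 ≤ v) (hv1 : v < 1) (hL : ∀ j, L j ≤ L' j)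
    (hload : L (placeTwo p s v).1 + v ≤ L' (placeTwo p s v).1) :
    ScheduledInv p a e T (u ++ [v]) L' (placeTwo p s v).2 := by
  have hseen := inv.seen
  have hw := window_append_of_le (a := a) (v := v) hen
  have hF : firstItems p.reserved a e T u = window a e u := by
    rw [firstItems, List.drop_eq_nil_of_le hnT.le, List.take_nil, List.append_nil]
  have hfirsts : s.firsts = window a e u := inv.firsts.trans hF
  have hmatched := inv.matched
  rw [S.placeTwo_eq hp (hseen ▸ hN), if_neg (by omega)] at hload ⊢
  rw [ScheduledInv, firstItems_append_of_window_eq hw (Or.inl hnT), hw, ← hfirsts,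
    List.length_append, List.length_singleton]
  rw [← hfirsts] at hmatched
  rw [ScheduledInv, ← hfirsts, ← hmatched] at inv
  rw [numMatched] at hmatched ⊢
  split_ifs at hload ⊢ with hlt
  · rw [show min (min (u.length + 1) T - e) (nonGood p.declared s.firsts).length =
      s.matched + 1 by omega]
    refine inv.append_matched hL hv ?_ hload
    rw [hF, ← hfirsts, List.getD_eq_getElem _ _ hlt.2.2]
    exact (mem_nonGood.1 (List.getElem_mem _)).1
  · rw [show min (min (u.length + 1) T - e) (nonGood p.declared s.firsts).length =
      s.matched by omega]
    exact inv.append_separate hL hv hv1 hload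

theorem ScheduledInv.placeTwo_of_le (inv : ScheduledInv p a e T u L s) (S : p.Schedule N a e T)
    (hp : p.plain = false) (hN : u.length < N) (hTn : T ≤ u.length) (hv : 1 / 2 ≤ v) (hv1 : v < 1)
    (hL0 : ∀ j, 0 ≤ L j) (hL : ∀ j, L j ≤ L' j)
    (hload : L (placeTwo p s v).1 + v ≤ L' (placeTwo p s v).1) :
    ScheduledInv p a e T (u ++ [v]) L' (placeTwo p s v).2 := by
  have hseen := inv.seen
  have hfirsts := congrArg List.length inv.firsts
  have hae := S.start_le
  have hle := S.le_reserved
  have hen := S.end_le.trans hTn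
  have hw := window_append_of_le (a := a) (v := v) hen
  rw [length_firstItems] at hfirsts
  have hm : numMatched (u.length + 1) e T = numMatched u.length e T := by
    funext k
    rw [numMatched, numMatched, min_eq_right hTn, min_eq_right (hTn.trans (Nat.le_succ _))]
  rw [S.placeTwo_eq hp (hseen ▸ hN)] at hload ⊢
  rw [ScheduledInv, List.length_append, List.length_singleton, hw, hm]
  by_cases hlt : u.length - T < p.reserved - (e - a)
  · rw [if_pos (by omega)] at hload ⊢
    rw [firstItems_append_of_resumed hen hTn hlt]
    exact inv.append_first hL hL0 hv hload
  · rw [if_neg (by omega), if_neg (by omega)] at hload ⊢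
    rw [firstItems_append_of_window_eq hw (Or.inr (not_lt.1 hlt))]
    exact inv.append_separate hL hv hv1 hload

theorem scheduledInv_stateAfter (S : p.Schedule N a e T) (hp : p.plain = false) (h : List ℝ)
    (hh : IsInput h) (hN : (twos h).length ≤ N) :
    ScheduledInv p a e T (twos h) (weightIn p twoSize h) (stateAfter p h) := by
  induction h using List.reverseRecOn with
  | nil =>
    refine ⟨rfl, by simp [State.start, stateAfter, twos, firstItems, window],
      by simp [State.start, stateAfter, twos, numMatched], ?_, ?_, ?_,
      DNF.Fills.start fun i => weightIn_nonneg (by simp) _, 0, Or.inl ⟨rfl, rfl⟩, ?_⟩ <;>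
    simp [twos, firstItems, window, numMatched]
  | append_singleton h v ih =>
    have hh' : IsInput h := fun x hx => hh x (List.mem_append_left _ hx)
    have hv01 := hh v (by simp)
    have hload := weightIn_append_self p twoSize h v
    rw [stateAfter_append]
    by_cases hv : v < 1 / 2
    · have hstep : step p (stateAfter p h) v = placeSmall p (stateAfter p h) v := if_pos hv
      obtain ⟨hseen, hfirsts, hmatched, hbins⟩ := placeSmall_two p (stateAfter p h) v
      rw [twos_append_of_lt hv] at hN ⊢
      rw [hstep, weightIn_append_of_eq_zero (w := twoSize) (if_pos hv)]
      exact TwoInv.congr_state (ih hh' hN) hseen hfirsts hmatched hbins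
    · have hstep : step p (stateAfter p h) v = placeTwo p (stateAfter p h) v := if_neg hv
      rw [twos_append_of_not_lt hv] at hN ⊢
      rw [List.length_append, List.length_singleton] at hN
      rw [hstep, twoSize, if_neg hv] at hload
      rw [hstep]
      have inv := ih hh' (Nat.le_of_succ_le hN)
      have hL0 : ∀ j, 0 ≤ weightIn p twoSize h j :=
        weightIn_nonneg fun x hx => twoSize_nonneg (hh' x hx).1
      have hL := weightIn_le_append (p := p) (h := h) (twoSize_nonneg hv01.1)
      rcases lt_or_ge (twos h).length e with he | he
      · exact inv.placeTwo_of_lt S hp hN he (not_lt.1 hv) hv01.2 hL0 hL hload.ge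
      rcases lt_or_ge (twos h).length T with hT | hT
      · exact inv.placeTwo_of_le_of_lt S hp hN he hT (not_lt.1 hv) hv01.2 hL hload.ge
      · exact inv.placeTwo_of_le S hp hN hT (not_lt.1 hv) hv01.2 hL0 hL hload.ge

end Schedule

end TwoItems

/-! ### The largest items -/

/-- The number of entries of `l` of size at least `θ`. -/
noncomputable def bigCount (θ : ℝ) (l : List ℝ) : ℕ := l.countP fun x => θ ≤ x

/-- The positions of the `g` largest entries of `l`. -/
noncomputable def goodSet (g : ℕ) (l : List ℝ) : Finset ℕ :=
  (Finset.range l.length).filter fun i => rank l i < g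

section Rank

variable {l : List ℝ} {θ : ℝ} {g i k : ℕ}

theorem bigCount_append (θ : ℝ) (l l' : List ℝ) :
    bigCount θ (l ++ l') = bigCount θ l + bigCount θ l' := List.countP_append

theorem bigCount_le_length (θ : ℝ) (l : List ℝ) : bigCount θ l ≤ l.length := List.countP_le_length

theorem bigCount_eq_card (θ : ℝ) (l : List ℝ) :
    bigCount θ l = ((Finset.range l.length).filter fun i => θ ≤ l.getD i 0).card := by
  induction l using List.reverseRecOn with
  | nil => rfl
  | append_singleton l v ih =>
    rw [bigCount_append, ih, Finset.card_filter, Finset.card_filter, List.length_append,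
      List.length_singleton, Finset.sum_range_succ]
    congr 1
    · refine Finset.sum_congr rfl fun i hi => ?_
      rw [List.getD_append _ _ _ _ (Finset.mem_range.1 hi)]
    · simp [bigCount, List.countP_singleton]

theorem rank_lt_rank (hi : i < l.length)
    (h : l.getD k 0 < l.getD i 0 ∨ (l.getD k 0 = l.getD i 0 ∧ i < k)) : rank l i < rank l k := by
  refine Finset.card_lt_card (Finset.ssubset_iff_of_subset (fun j hj => ?_) |>.2 ⟨i, ?_, ?_⟩)
  · rw [Finset.mem_filter] at hj ⊢
    refine ⟨hj.1, ?_⟩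
    grind
  · exact Finset.mem_filter.2 ⟨Finset.mem_range.2 hi, h⟩
  · simp

theorem rank_lt_length (hi : i < l.length) : rank l i < l.length := by
  refine (Finset.card_lt_card (Finset.ssubset_iff_of_subset (Finset.filter_subset _ _) |>.2
    ⟨i, Finset.mem_range.2 hi, ?_⟩)).trans_eq (Finset.card_range _)
  simp

theorem rank_injOn (l : List ℝ) : Set.InjOn (rank l) (Finset.range l.length) := by
  intro i hi k hk h
  have hi := Finset.mem_range.1 hi
  have hk := Finset.mem_range.1 hk
  by_contra hne
  rcases lt_trichotomy (l.getD k 0) (l.getD i 0) with hlt | heq | hlt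
  · exact (rank_lt_rank hi (Or.inl hlt)).ne h
  · rcases lt_or_gt_of_ne hne with hik | hki
    · exact (rank_lt_rank hi (Or.inr ⟨heq, hik⟩)).ne h
    · exact (rank_lt_rank hk (Or.inr ⟨heq.symm, hki⟩)).ne' h
  · exact (rank_lt_rank hk (Or.inl hlt)).ne' h

theorem image_rank (l : List ℝ) : (Finset.range l.length).image (rank l) =
    Finset.range l.length := by
  refine Finset.eq_of_subset_of_card_le (Finset.image_subset_iff.2 fun i hi =>
    Finset.mem_range.2 (rank_lt_length (Finset.mem_range.1 hi))) ?_
  rw [Finset.card_image_of_injOn (rank_injOn l)]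

theorem card_goodSet (hg : g ≤ l.length) : (goodSet g l).card = g := by
  have himage : (goodSet g l).image (rank l) = Finset.range g := by
    rw [goodSet, ← Finset.filter_image (p := (· < g)), image_rank]
    ext x
    rw [Finset.mem_filter, Finset.mem_range, Finset.mem_range]
    omega
  have hinj : Set.InjOn (rank l) (goodSet g l) := (rank_injOn l).mono (Finset.filter_subset _ _)
  rw [← Finset.card_image_of_injOn hinj, himage, Finset.card_range]

theorem nonGood_nodup (g : ℕ) (l : List ℝ) : (nonGood g l).Nodup := List.nodup_range.filter _

theorem length_nonGood (hg : g ≤ l.length) : (nonGood g l).length = l.length - g := by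
  have hset : (nonGood g l).toFinset = (Finset.range l.length).filter fun i => ¬ rank l i < g := by
    ext i
    rw [List.mem_toFinset, mem_nonGood, Finset.mem_filter, Finset.mem_range, not_lt]
  have hcard := Finset.card_filter_add_card_filter_not (s := Finset.range l.length) (rank l · < g)
  have hgood := card_goodSet hg
  rw [← List.toFinset_card_of_nodup (nonGood_nodup g l), hset]
  rw [goodSet] at hgood
  rw [Finset.card_range] at hcard
  omega

theorem le_of_mem_goodSet (hg : g ≤ bigCount θ l) (hi : i ∈ goodSet g l) : θ ≤ l.getD i 0 := by
  by_contra! hlt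
  have hcount : bigCount θ l ≤ rank l i := by
    rw [bigCount_eq_card]
    refine Finset.card_le_card fun j hj => ?_
    rw [Finset.mem_filter] at hj ⊢
    exact ⟨hj.1, Or.inl (hlt.trans_le hj.2)⟩
  exact (hg.trans hcount).not_gt (Finset.mem_filter.1 hi).2

end Rank

/-! ### Counting the covered bins -/

/-- The number of entries of size at least `θ` among the first `i` entries of `u`. -/
noncomputable def prefixCount (θ : ℝ) (u : List ℝ) (i : ℕ) : ℕ := bigCount θ (u.take i)

/-- The reserved bins that get covered when each of them receives enough small items to cover it
together with a 2-item of size at least `θ`: those of the `g` largest items of `U₁`, the first `m`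
of those that are to be completed by another 2-item, and those of the large items of `U₂`. -/
noncomputable def coveredReserved (θ : ℝ) (g m : ℕ) (U₁ U₂ : List ℝ) : Finset ℕ :=
  goodSet g U₁ ∪ ((nonGood g U₁).take m).toFinset ∪
    ((Finset.range U₂.length).filter fun i => θ ≤ U₂.getD i 0).image (U₁.length + ·)

/-- The advice `p` makes the strategy put small items of total size at least `d` into every reserved
bin when it serves `σ`. -/
structure Advice.SmallReady (p : Advice) (σ : List ℝ) (d : ℝ) : Prop where
  plain : p.plain = false
  dUp_pos : 0 < p.dUp
  le_dUp : d ≤ p.dUp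
  sUp_nonneg : 0 ≤ p.sUp
  sDown_le : p.sDown ≤ p.sUp
  numBlack_le_extra : p.numBlack ≤ p.blackExtra
  numBlack_le_count : p.numBlack ≤ blackCount p.dUp p.sUp σ
  le_whiteVolume : 2 * ((p.reserved : ℝ) - p.numBlack) * d ≤ whiteVolume p.dUp d σ

section PrefixCount

variable (θ : ℝ) (u : List ℝ) {a e : ℕ}

theorem prefixCount_add_bigCount_window (hae : a ≤ e) :
    prefixCount θ u a + bigCount θ (window a e u) = prefixCount θ u e := by
  have htake : u.take e = u.take a ++ window a e u := by
    conv_lhs => rw [← List.take_append_drop a (u.take e), List.take_take, min_eq_left hae]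
    rfl
  rw [prefixCount, prefixCount, htake, bigCount_append]

theorem prefixCount_le (hae : a ≤ e) : prefixCount θ u e ≤ prefixCount θ u a + (e - a) := by
  have hlen := bigCount_le_length θ (window a e u)
  rw [length_window] at hlen
  rw [← prefixCount_add_bigCount_window θ u hae]
  omega

theorem prefixCount_mono : Monotone (prefixCount θ u) := fun _ _ hae =>
  (Nat.le_add_right _ _).trans_eq (prefixCount_add_bigCount_window θ u hae)

theorem bigCount_take_drop (T k : ℕ) : prefixCount θ u T + bigCount θ ((u.drop T).take k) =
    prefixCount θ u (T + min k (u.length - T)) := by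
  rw [← prefixCount_add_bigCount_window θ u (Nat.le_add_right T _), window, List.drop_take,
    Nat.add_sub_cancel_left, ← List.length_drop, ← List.take_eq_take_min]

end PrefixCount

section CoveredReserved

variable {θ : ℝ} {g m : ℕ} {U₁ U₂ : List ℝ}

theorem card_coveredReserved (hg : g ≤ U₁.length) (hm : m ≤ U₁.length - g) :
    (coveredReserved θ g m U₁ U₂).card = g + m + bigCount θ U₂ := by
  have hmatched : ∀ i ∈ ((nonGood g U₁).take m).toFinset, i < U₁.length ∧ g ≤ rank U₁ i :=
    fun i hi => mem_nonGood.1 (List.mem_of_mem_take (List.mem_toFinset.1 hi))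
  have hgood : ∀ i ∈ goodSet g U₁, i < U₁.length ∧ rank U₁ i < g := fun i hi => by
    simpa only [goodSet, Finset.mem_filter, Finset.mem_range] using hi
  rw [coveredReserved, Finset.card_union_of_disjoint, Finset.card_union_of_disjoint,
    card_goodSet hg, List.toFinset_card_of_nodup ((nonGood_nodup _ _).sublist
      (List.take_sublist _ _)), List.length_take, length_nonGood hg, min_eq_left hm,
    Finset.card_image_of_injective _ (add_right_injective _), bigCount_eq_card]
  · exact Finset.disjoint_left.2 fun i hi hi' => (hmatched i hi').2.not_gt (hgood i hi).2
  · refine Finset.disjoint_left.2 fun i hi hi' => ?_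
    obtain ⟨k, -, rfl⟩ := Finset.mem_image.1 hi'
    refine (Nat.le_add_right U₁.length k).not_gt ?_
    exact (Finset.mem_union.1 hi).elim (fun h => (hgood _ h).1) fun h => (hmatched _ h).1

theorem TwoInv.one_le_load_of_mem_coveredReserved {n : ℕ} {L : Bin → ℝ} {s : State}
    (inv : TwoInv n (U₁ ++ U₂) (nonGood g U₁) m L s) (hg : g ≤ bigCount θ U₁)
    (hm : m ≤ U₁.length - g) {M : Bin → ℝ} (hM : ∀ j, 0 ≤ M j)
    (hθ : ∀ i < (U₁ ++ U₂).length, 1 - θ ≤ M (.reserved i)) {i : ℕ}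
    (hi : i ∈ coveredReserved θ g m U₁ U₂) : 1 ≤ M (.reserved i) + L (.reserved i) := by
  have hlen : (U₁ ++ U₂).length = U₁.length + U₂.length := List.length_append
  simp only [coveredReserved, Finset.mem_union] at hi
  rcases hi with (hi | hi) | hi
  · have hlt := Finset.mem_range.1 (Finset.mem_filter.1 hi).1
    have hload := inv.le_load i (by omega)
    rw [List.getD_append _ _ _ _ hlt] at hload
    linarith [le_of_mem_goodSet hg hi, hθ i (by omega)]
  · obtain ⟨q, hq, rfl⟩ := List.getElem_of_mem (List.mem_toFinset.1 hi)
    have hB : (nonGood g U₁).length = U₁.length - g :=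
      length_nonGood (hg.trans (bigCount_le_length _ _))
    rw [List.length_take, hB, min_eq_left hm] at hq
    have hload := inv.one_le_load q hq
    rw [List.getD_eq_getElem _ _ (by omega)] at hload
    rw [List.getElem_take]
    linarith [hM (.reserved (nonGood g U₁)[q])]
  · obtain ⟨k, hk, rfl⟩ := Finset.mem_image.1 hi
    obtain ⟨hk, hbig⟩ := Finset.mem_filter.1 hk
    have hlt : U₁.length + k < (U₁ ++ U₂).length := hlen ▸ Nat.add_lt_add_left
      (Finset.mem_range.1 hk) _
    have hload := inv.le_load _ hlt
    rw [List.getD_append_right _ _ _ _ (Nat.le_add_right _ _), Nat.add_sub_cancel_left] at hload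
    linarith [hθ _ hlt]

end CoveredReserved

section Covered

variable {t : Tape} {σ : List ℝ}

theorem card_add_add_le_covered {S : Finset ℕ} {n₂ n₁ : ℕ}
    (hS : ∀ i ∈ S, 1 ≤ weightIn (readAdvice t) id σ (.reserved i))
    (h₂ : ∀ i < n₂, 1 ≤ weightIn (readAdvice t) id σ (.two i))
    (h₁ : ∀ i < n₁, 1 ≤ weightIn (readAdvice t) id σ (.small i)) :
    S.card + n₂ + n₁ ≤ modifiedDualHarmonic.covered t σ := by
  classical
  have hcard : ((S.image Bin.reserved ∪ (Finset.range n₂).image Bin.two) ∪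
      (Finset.range n₁).image Bin.small).card = S.card + n₂ + n₁ := by
    rw [Finset.card_union_of_disjoint, Finset.card_union_of_disjoint,
      Finset.card_image_of_injective _ fun _ _ => Bin.reserved.inj,
      Finset.card_image_of_injective _ fun _ _ => Bin.two.inj,
      Finset.card_image_of_injective _ fun _ _ => Bin.small.inj, Finset.card_range,
      Finset.card_range]
    all_goals simp [Finset.disjoint_left]
    grind
  rw [← hcard]
  refine card_le_covered fun j hj => ?_
  simp only [Finset.mem_union, Finset.mem_image, Finset.mem_range] at hj
  rcases hj with (⟨i, hi, rfl⟩ | ⟨i, hi, rfl⟩) | ⟨i, hi, rfl⟩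
  exacts [hS i hi, h₂ i hi, h₁ i hi]

theorem Advice.SmallReady.add_add_le_covered {θ : ℝ} {g m n : ℕ} {U₁ U₂ : List ℝ}
    (ready : (readAdvice t).SmallReady σ (1 - θ)) (hσ : IsInput σ)
    (inv : TwoInv n (U₁ ++ U₂) (nonGood g U₁) m (weightIn (readAdvice t) twoSize σ)
      (stateAfter (readAdvice t) σ)) (hg : g ≤ bigCount θ U₁) (hm : m ≤ U₁.length - g)
    (hr : (U₁ ++ U₂).length ≤ (readAdvice t).reserved) :
    g + m + bigCount θ U₂ + (stateAfter (readAdvice t) σ).twoBins.active +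
      (stateAfter (readAdvice t) σ).smallBins.active ≤ modifiedDualHarmonic.covered t σ := by
  have small := smallInv_stateAfter ready.plain ready.dUp_pos ready.le_dUp ready.sDown_le
    ready.numBlack_le_extra σ hσ
  have hsmall : ∀ j, 0 ≤ weightIn (readAdvice t) smallSize σ j :=
    weightIn_nonneg fun v hv => smallSize_nonneg (hσ v hv).1
  have htwo : ∀ j, 0 ≤ weightIn (readAdvice t) twoSize σ j :=
    weightIn_nonneg fun v hv => twoSize_nonneg (hσ v hv).1
  have hload : ∀ i < (U₁ ++ U₂).length,
      1 - θ ≤ weightIn (readAdvice t) smallSize σ (.reserved i) := fun i hi =>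
    small.le_load ready.le_dUp ready.numBlack_le_count ready.le_whiteVolume (hi.trans_le hr)
  rw [← card_coveredReserved (hg.trans (bigCount_le_length _ _)) hm]
  refine card_add_add_le_covered (fun i hi => ?_) (fun i hi => ?_) fun i hi => ?_ <;>
    rw [weightIn_id]
  · exact inv.one_le_load_of_mem_coveredReserved hg hm hsmall hload hi
  · exact (inv.separate.one_le i hi).trans (le_add_of_nonneg_left (hsmall _))
  · exact (small.separate.one_le i hi).trans (le_add_of_nonneg_right (htwo _))

theorem Advice.SmallReady.le_covered {θ : ℝ} {a e T m l : ℕ}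
    (ready : (readAdvice t).SmallReady σ (1 - θ))
    (S : (readAdvice t).Schedule (twos σ).length a e T) (hσ : IsInput σ) (he : e ≤ (twos σ).length)
    (hg : prefixCount θ (twos σ) a + (readAdvice t).declared ≤ prefixCount θ (twos σ) e)
    (hmT : m ≤ min (twos σ).length T - e) (hm : m ≤ e - a - (readAdvice t).declared)
    (hl : l = min ((readAdvice t).reserved - (e - a)) ((twos σ).length - T)) :
    ((twos σ).length : ℝ) / 2 + ((readAdvice t).declared + ((m : ℝ) - (e - a) - l) / 2 +
      (prefixCount θ (twos σ) (T + l) - prefixCount θ (twos σ) T)) - 1 / 2 +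
      2 / 3 * (smallVolume σ - 2 * ((readAdvice t).reserved - (readAdvice t).numBlack) *
        (readAdvice t).dUp - (readAdvice t).numBlack * (readAdvice t).sUp - 1) ≤
    (modifiedDualHarmonic.covered t σ : ℝ) := by
  have small := smallInv_stateAfter ready.plain ready.dUp_pos ready.le_dUp ready.sDown_le
    ready.numBlack_le_extra σ hσ
  have two := scheduledInv_stateAfter S ready.plain σ hσ le_rfl
  have hr := S.le_reserved
  have hwindow := prefixCount_add_bigCount_window θ (twos σ) S.start_le
  have hresumed := bigCount_take_drop θ (twos σ) T ((readAdvice t).reserved - (e - a))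
  have hlen : (window a e (twos σ)).length = e - a := by rw [length_window, min_eq_left he]
  have hbig := bigCount_le_length θ (window a e (twos σ))
  rw [← hl] at hresumed
  rw [ScheduledInv, numMatched, length_nonGood (by omega)] at two
  have hcovered := ready.add_add_le_covered hσ two (by omega) (min_le_right _ _)
    (by rw [← firstItems, length_firstItems]; omega)
  have hsmall := small.le_active ready.sUp_nonneg
  obtain ⟨k, hk, hN⟩ := two.count
  have hk := hk.le_active
  rw [length_firstItems, min_eq_left he, ← hl] at hN
  have hmM := le_min hmT (hlen ▸ hm)
  generalize min (min (twos σ).length T - e) _ = M at hcovered hN hmM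
  have hae := S.start_le
  have hN' : (twos σ).length + a ≤
      e + l + M + (2 * (stateAfter (readAdvice t) σ).twoBins.active + 1) := by omega
  rify at hcovered hN' hmM hresumed
  linarith

end Covered

/-! ### The optimum -/

theorem exists_order_statistic {ι : Type*} (A : Finset ι) (f : ι → ℝ) {μ : ℕ} (hμ0 : 0 < μ)
    (hμ : μ ≤ A.card) : ∃ a ∈ A, μ ≤ (A.filter fun x => f x ≤ f a).card ∧
      (A.filter fun x => f x < f a).card < μ := by
  obtain ⟨b, hb, hbmax⟩ := A.exists_max_image f (Finset.card_pos.1 (hμ0.trans_le hμ))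
  have hne : (A.filter fun a => μ ≤ (A.filter fun x => f x ≤ f a).card).Nonempty :=
    ⟨b, Finset.mem_filter.2 ⟨hb, by rwa [Finset.filter_true_of_mem hbmax]⟩⟩
  obtain ⟨a, ha, hamin⟩ := Finset.exists_min_image _ f hne
  obtain ⟨haA, hale⟩ := Finset.mem_filter.1 ha
  refine ⟨a, haA, hale, ?_⟩
  by_contra! hge
  obtain ⟨c, hc, hcmax⟩ := Finset.exists_max_image _ f (Finset.card_pos.1 (hμ0.trans_le hge))
  obtain ⟨hcA, hca⟩ := Finset.mem_filter.1 hc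
  have hle : μ ≤ (A.filter fun x => f x ≤ f c).card :=
    hge.trans (Finset.card_le_card fun x hx =>
      Finset.mem_filter.2 ⟨(Finset.mem_filter.1 hx).1, hcmax x hx⟩)
  exact (hamin c (Finset.mem_filter.2 ⟨hcA, hle⟩)).not_gt hca

theorem countP_eq_card (l : List ℝ) (P : ℝ → Bool) :
    l.countP P = (Finset.univ.filter fun i : Fin l.length => P (l.get i)).card := by
  rw [Finset.card_filter]
  refine Eq.trans ?_ (Fin.sum_univ_fun_getElem l fun v => if P v then 1 else 0).symm
  induction l with
  | nil => rfl
  | cons v l ih => rw [List.countP_cons, ih, List.map_cons, List.sum_cons, add_comm]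

/-- The total weight `w` of the items that the placement `f` puts into bin `j`. -/
noncomputable def binWeight {β : Type} [DecidableEq β] (w : ℝ → ℝ) (σ : List ℝ)
    (f : Fin σ.length → β) (j : β) : ℝ :=
  ∑ i with f i = j, w (σ.get i)

/-- The items of size at least `1 / 2` that the placement `f` puts into bin `j`. -/
noncomputable def twoItems {β : Type} [DecidableEq β] (σ : List ℝ) (f : Fin σ.length → β) (j : β) :
    Finset (Fin σ.length) :=
  Finset.univ.filter fun i => f i = j ∧ ¬ σ.get i < 1 / 2

/-- The bins covered by the placement `f` that contain exactly `q` items of size at least `1 / 2`.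
-/
noncomputable def coveredWith {β : Type} [DecidableEq β] (q : ℕ) (σ : List ℝ)
    (f : Fin σ.length → β) : Finset β :=
  (Finset.univ.image f).filter fun j => 1 ≤ load σ f j ∧ (twoItems σ f j).card = q

/-- The covered bins with a single item of size at least `1 / 2` that contain small items of total
size at least `d`. -/
noncomputable def richBins {β : Type} [DecidableEq β] (d : ℝ) (σ : List ℝ)
    (f : Fin σ.length → β) : Finset β :=
  (coveredWith 1 σ f).filter fun j => d ≤ binWeight smallSize σ f j

/-- The rich bins that contain a black item, that is, a small item of size at least `D`. -/
noncomputable def blackBins {β : Type} [DecidableEq β] (D d : ℝ) (σ : List ℝ)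
    (f : Fin σ.length → β) : Finset β :=
  (richBins d σ f).filter fun j => ∃ i, f i = j ∧ σ.get i < 1 / 2 ∧ D ≤ σ.get i

section Placement

variable {β : Type} [DecidableEq β] {σ : List ℝ} {f : Fin σ.length → β} {w : ℝ → ℝ} {D d θ : ℝ}
  {j : β}

theorem sum_binWeight (w : ℝ → ℝ) (σ : List ℝ) (f : Fin σ.length → β) :
    ∑ j ∈ Finset.univ.image f, binWeight w σ f j = (σ.map w).sum :=
  (Finset.sum_fiberwise_of_maps_to (fun i _ => Finset.mem_image_of_mem f (Finset.mem_univ i))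
    _).trans (Fin.sum_univ_fun_getElem σ w)

theorem binWeight_nonneg (hw : ∀ v ∈ σ, 0 ≤ w v) (j : β) : 0 ≤ binWeight w σ f j :=
  Finset.sum_nonneg fun i _ => hw _ (List.get_mem σ i)

theorem le_binWeight (hw : ∀ v ∈ σ, 0 ≤ w v) (i : Fin σ.length) :
    w (σ.get i) ≤ binWeight w σ f (f i) :=
  Finset.single_le_sum (f := fun i => w (σ.get i)) (fun i _ => hw _ (List.get_mem σ i))
    (Finset.mem_filter.2 ⟨Finset.mem_univ i, rfl⟩)

theorem sum_binWeight_le (hw : ∀ v ∈ σ, 0 ≤ w v) {A : Finset β} (hA : A ⊆ Finset.univ.image f) :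
    ∑ j ∈ A, binWeight w σ f j ≤ (σ.map w).sum :=
  (Finset.sum_le_sum_of_subset_of_nonneg hA fun j _ _ => binWeight_nonneg hw j).trans_eq
    (sum_binWeight w σ f)

theorem load_eq_add_sum_twoItems (j : β) :
    load σ f j = binWeight smallSize σ f j + ∑ i ∈ twoItems σ f j, σ.get i := by
  rw [load, binWeight, twoItems, Finset.sum_filter, Finset.sum_filter, ← Finset.sum_add_distrib]
  refine Finset.sum_congr rfl fun i _ => ?_
  by_cases hj : f i = j <;> by_cases hi : σ.get i < 1 / 2 <;>
    simp only [hj, hi, smallSize, if_true, if_false, true_and, false_and, not_true_eq_false,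
      not_false_eq_true, add_zero, zero_add]

theorem sum_card_twoItems (σ : List ℝ) (f : Fin σ.length → β) :
    ∑ j ∈ Finset.univ.image f, (twoItems σ f j).card = (twos σ).length := by
  rw [twos, ← List.countP_eq_length_filter, countP_eq_card, Finset.card_eq_sum_card_fiberwise
    (f := f) (t := Finset.univ.image f)
    (fun i _ => Finset.mem_image_of_mem f (Finset.mem_univ i))]
  refine Finset.sum_congr rfl fun j _ => congrArg Finset.card (Finset.ext fun i => ?_)
  simp only [twoItems, Finset.mem_filter, Finset.mem_univ, true_and, decide_eq_true_eq, and_comm]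

theorem coveredWith_subset (q : ℕ) : coveredWith q σ f ⊆ Finset.univ.image f :=
  Finset.filter_subset _ _

theorem numCovered_eq_card :
    numCovered σ f = ((Finset.univ.image f).filter fun j => 1 ≤ load σ f j).card := by
  rw [numCovered]
  congr!

theorem card_coveredWith_le_numCovered (q : ℕ) : (coveredWith q σ f).card ≤ numCovered σ f := by
  rw [numCovered_eq_card]
  exact Finset.card_le_card (Finset.monotone_filter_right _ fun _ _ h => h.1)

theorem two_mul_numCovered_le : 2 * numCovered σ f ≤
    (twos σ).length + (coveredWith 1 σ f).card + 2 * (coveredWith 0 σ f).card := by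
  rw [numCovered_eq_card, ← sum_card_twoItems σ f, coveredWith, coveredWith, Finset.card_filter,
    Finset.card_filter, Finset.card_filter, Finset.mul_sum, Finset.mul_sum,
    ← Finset.sum_add_distrib, ← Finset.sum_add_distrib]
  refine Finset.sum_le_sum fun j _ => ?_
  by_cases hj : 1 ≤ load σ f j <;> simp only [hj, true_and, false_and, if_true, if_false]
  · split_ifs <;> omega
  · omega

theorem card_coveredWith_one_le_length_twos : (coveredWith 1 σ f).card ≤ (twos σ).length := by
  rw [← sum_card_twoItems σ f, coveredWith, Finset.card_filter]
  refine Finset.sum_le_sum fun j _ => ?_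
  split_ifs <;> omega

theorem one_le_binWeight_of_mem_coveredWith_zero (hj : j ∈ coveredWith 0 σ f) :
    1 ≤ binWeight smallSize σ f j := by
  obtain ⟨-, hload, hcard⟩ := Finset.mem_filter.1 hj
  rwa [load_eq_add_sum_twoItems, Finset.card_eq_zero.1 hcard, Finset.sum_empty, add_zero] at hload

theorem disjoint_coveredWith {q q' : ℕ} (hq : q ≠ q') :
    Disjoint (coveredWith q σ f) (coveredWith q' σ f) :=
  Finset.disjoint_filter.2 fun _ _ h h' => hq (h.2.symm.trans h'.2)

theorem card_coveredWith_one_le_add (θ : ℝ) : (coveredWith 1 σ f).card ≤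
    (richBins (1 - θ) σ f).card + (twos σ).countP (fun x => θ < x) := by
  rw [← Finset.card_filter_add_card_filter_not fun j => 1 - θ ≤ binWeight smallSize σ f j,
    ← richBins, add_le_add_iff_left, twos, List.countP_filter, countP_eq_card]
  refine (Finset.card_le_card fun j hj => ?_).trans (Finset.card_image_le (f := f))
  obtain ⟨hj, hpoor⟩ := Finset.mem_filter.1 hj
  obtain ⟨-, hload, hcard⟩ := Finset.mem_filter.1 hj
  obtain ⟨i, hi⟩ := Finset.card_eq_one.1 hcard
  obtain ⟨-, rfl, hitwo⟩ := Finset.mem_filter.1 (hi ▸ Finset.mem_singleton_self i)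
  rw [load_eq_add_sum_twoItems, hi, Finset.sum_singleton] at hload
  refine Finset.mem_image_of_mem f (Finset.mem_filter.2 ⟨Finset.mem_univ _, ?_⟩)
  rw [Bool.and_eq_true, decide_eq_true_eq, decide_eq_true_eq]
  exact ⟨by linarith, hitwo⟩

theorem whiteSize_nonneg (hd : 0 ≤ d) {v : ℝ} (hv : 0 ≤ v) : 0 ≤ whiteSize D d v := by
  rw [whiteSize]
  split_ifs
  · exact le_min hv hd
  · exact le_rfl

theorem le_binWeight_whiteSize (hσ : ∀ v ∈ σ, 0 ≤ v) (hd : 0 ≤ d)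
    (hj : d ≤ binWeight smallSize σ f j)
    (hwhite : ∀ i, f i = j → σ.get i < 1 / 2 → σ.get i < D) :
    d ≤ binWeight (whiteSize D d) σ f j := by
  have hnonneg : ∀ v ∈ σ, 0 ≤ whiteSize D d v := fun v hv => whiteSize_nonneg hd (hσ v hv)
  by_cases hlarge : ∃ i, f i = j ∧ σ.get i < 1 / 2 ∧ d ≤ σ.get i
  · obtain ⟨i, rfl, hi, hdi⟩ := hlarge
    refine le_trans (le_of_eq ?_) (le_binWeight hnonneg i)
    rw [whiteSize, if_pos ⟨hi, hwhite i rfl hi⟩, min_eq_right hdi]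
  · push Not at hlarge
    refine hj.trans (Finset.sum_le_sum fun i hi => ?_)
    obtain ⟨-, hij⟩ := Finset.mem_filter.1 hi
    rw [smallSize]
    split_ifs with hi
    · rw [whiteSize, if_pos ⟨hi, hwhite i hij hi⟩, min_eq_left (hlarge i hij hi).le]
    · exact hnonneg _ (List.get_mem σ i)

theorem blackBins_subset : blackBins D d σ f ⊆ richBins d σ f := Finset.filter_subset _ _

theorem richBins_subset : richBins d σ f ⊆ coveredWith 1 σ f := Finset.filter_subset _ _

theorem card_sub_card_mul_eq (D d : ℝ) (σ : List ℝ) (f : Fin σ.length → β) :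
    ((richBins d σ f).card - ((blackBins D d σ f).card : ℝ)) * d =
      ∑ _j ∈ richBins d σ f \ blackBins D d σ f, d := by
  rw [Finset.sum_const, nsmul_eq_mul, Finset.cast_card_sdiff blackBins_subset]

theorem card_sub_card_mul_le_whiteVolume (hσ : ∀ v ∈ σ, 0 ≤ v) (hd : 0 ≤ d) :
    ((richBins d σ f).card - ((blackBins D d σ f).card : ℝ)) * d ≤ whiteVolume D d σ := by
  rw [card_sub_card_mul_eq]
  refine (Finset.sum_le_sum fun j hj => ?_).trans
    (sum_binWeight_le (fun v hv => whiteSize_nonneg hd (hσ v hv))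
      (Finset.sdiff_subset.trans (richBins_subset.trans (coveredWith_subset 1))))
  obtain ⟨hrich, hblack⟩ := Finset.mem_sdiff.1 hj
  refine le_binWeight_whiteSize hσ hd (Finset.mem_filter.1 hrich).2 fun i hij hi => ?_
  by_contra! hDi
  exact hblack (Finset.mem_filter.2 ⟨hrich, i, hij, hi, hDi⟩)

theorem card_add_card_sub_card_mul_add_sum_le (hσ : ∀ v ∈ σ, 0 < v) : (coveredWith 0 σ f).card +
    ((richBins d σ f).card - ((blackBins D d σ f).card : ℝ)) * d +
      ∑ j ∈ blackBins D d σ f, binWeight smallSize σ f j ≤ smallVolume σ := by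
  have hnonneg : ∀ v ∈ σ, 0 ≤ smallSize v := fun v hv => smallSize_nonneg (hσ v hv)
  have hpure : ((coveredWith 0 σ f).card : ℝ) ≤
      ∑ j ∈ coveredWith 0 σ f, binWeight smallSize σ f j := by
    simpa using Finset.card_nsmul_le_sum _ _ 1 fun j hj =>
      one_le_binWeight_of_mem_coveredWith_zero hj
  have hwhite : ∑ _j ∈ richBins d σ f \ blackBins D d σ f, d ≤
      ∑ j ∈ richBins d σ f \ blackBins D d σ f, binWeight smallSize σ f j :=
    Finset.sum_le_sum fun j hj => (Finset.mem_filter.1 (Finset.mem_sdiff.1 hj).1).2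
  have hdisjoint : Disjoint (coveredWith 0 σ f) (richBins d σ f) :=
    (disjoint_coveredWith zero_ne_one).mono_right richBins_subset
  have hsum := sum_binWeight_le (f := f) hnonneg (Finset.union_subset (coveredWith_subset 0)
    (richBins_subset (d := d).trans (coveredWith_subset 1)))
  rw [Finset.sum_union hdisjoint, ← Finset.sum_sdiff (blackBins_subset (D := D))] at hsum
  rw [card_sub_card_mul_eq, smallVolume]
  linarith

theorem exists_le_blackCount (hσ : ∀ v ∈ σ, 0 < v) {A : Finset β}
    (hA : ∀ j ∈ A, ∃ i, f i = j ∧ σ.get i < 1 / 2 ∧ D ≤ σ.get i) {μ : ℕ} (hμ : μ ≤ A.card) :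
    ∃ s, 0 ≤ s ∧ s < 1 / 2 ∧ (∀ s', s ≤ s' → μ ≤ blackCount D s' σ) ∧
      ((A.card : ℝ) - μ) * s ≤ ∑ j ∈ A, binWeight smallSize σ f j := by
  have hnonneg : ∀ v ∈ σ, 0 ≤ smallSize v := fun v hv => smallSize_nonneg (hσ v hv)
  rcases Nat.eq_zero_or_pos μ with rfl | hμ0
  · refine ⟨0, le_rfl, by norm_num, fun _ _ => Nat.zero_le _, ?_⟩
    rw [mul_zero]
    exact Finset.sum_nonneg fun j _ => binWeight_nonneg hnonneg j
  have : Nonempty (Fin σ.length) := by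
    obtain ⟨j, hj⟩ := Finset.card_pos.1 (hμ0.trans_le hμ)
    exact ⟨(hA j hj).choose⟩
  choose! ρ hbin hsmall hblack using hA
  obtain ⟨a, ha, hle, hlt⟩ := exists_order_statistic A (fun j => σ.get (ρ j)) hμ0 hμ
  have ha0 : 0 < σ.get (ρ a) := hσ _ (List.get_mem σ _)
  refine ⟨σ.get (ρ a), ha0.le, hsmall a ha, fun s' hs' => ?_, ?_⟩
  · rw [blackCount, countP_eq_card]
    refine hle.trans (Finset.card_le_card_of_injOn ρ (fun j hj => ?_) fun j hj j' hj' h => ?_)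
    · obtain ⟨hjA, hja⟩ := Finset.mem_filter.1 hj
      exact Finset.mem_filter.2 ⟨Finset.mem_univ _,
        decide_eq_true ⟨hsmall j hjA, hblack j hjA, hja.trans hs'⟩⟩
    · rw [← hbin j (Finset.mem_filter.1 hj).1, h, hbin j' (Finset.mem_filter.1 hj').1]
  · have hcard := Finset.card_filter_add_card_filter_not (s := A)
      fun j => σ.get (ρ j) < σ.get (ρ a)
    have hcount : (A.card : ℝ) ≤ μ + (A.filter fun j => ¬ σ.get (ρ j) < σ.get (ρ a)).card := by
      exact_mod_cast (by omega :
        A.card ≤ μ + (A.filter fun j => ¬ σ.get (ρ j) < σ.get (ρ a)).card)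
    refine (mul_le_mul_of_nonneg_right (sub_le_iff_le_add'.2 hcount) ha0.le).trans ?_
    rw [← nsmul_eq_mul]
    refine (Finset.card_nsmul_le_sum _ (binWeight smallSize σ f) _ fun j hj => ?_).trans
      (Finset.sum_le_sum_of_subset_of_nonneg (Finset.filter_subset _ A)
        fun j _ _ => binWeight_nonneg hnonneg j)
    obtain ⟨hjA, hja⟩ := Finset.mem_filter.1 hj
    have hρ := le_binWeight (f := f) hnonneg (ρ j)
    rw [hbin j hjA, smallSize, if_pos (hsmall j hjA)] at hρ
    exact (not_lt.1 hja).trans hρ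

end Placement

/-- The small items that an optimal packing of `σ` reserves: `k` bins contain only small items, and
`M` bins contain, besides a single item of size at least `1 / 2`, small items of total size at least
`1 - θ`. Of these `M` bins, `B` contain a black item, that is, a small item of size at least `D`. -/
structure SmallSupply (σ : List ℝ) (k : ℕ) (θ D : ℝ) (M B : ℕ) : Prop where
  black_le : B ≤ M
  white : ((M : ℝ) - B) * (1 - θ) ≤ whiteVolume D (1 - θ) σ
  black : ∀ μ ≤ B, ∃ s, 0 ≤ s ∧ s < 1 / 2 ∧ (∀ s', s ≤ s' → μ ≤ blackCount D s' σ) ∧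
    k + ((M : ℝ) - B) * (1 - θ) + ((B : ℝ) - μ) * s ≤ smallVolume σ

theorem SmallSupply.le_smallVolume {σ : List ℝ} {k M B : ℕ} {θ D : ℝ}
    (supply : SmallSupply σ k θ D M B) (hθ : θ ≤ 1) : (k : ℝ) ≤ smallVolume σ := by
  obtain ⟨s, -, -, -, hvolume⟩ := supply.black B le_rfl
  rw [sub_self, zero_mul, add_zero] at hvolume
  have hBM : (0 : ℝ) ≤ M - B := sub_nonneg.2 (Nat.cast_le.2 supply.black_le)
  have := mul_nonneg hBM (sub_nonneg.2 hθ)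
  linarith

theorem exists_smallSupply {σ : List ℝ} (hσ : IsInput σ) : ∃ m k : ℕ,
    2 * opt σ ≤ (twos σ).length + m + 2 * k ∧ m ≤ opt σ ∧ m ≤ (twos σ).length ∧
    ∀ θ D : ℝ, θ ≤ 1 → ∃ M B : ℕ, m ≤ M + (twos σ).countP (fun x => θ < x) ∧ M ≤ m ∧
      SmallSupply σ k θ D M B := by
  have hpos : ∀ v ∈ σ, 0 < v := fun v hv => (hσ v hv).1
  obtain ⟨f, -, hf⟩ := Finset.exists_mem_eq_sup
    (Finset.univ : Finset (Fin σ.length → Fin σ.length)) ⟨id, Finset.mem_univ _⟩ (numCovered σ)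
  have hopt : opt σ = numCovered σ f := hf
  refine ⟨(coveredWith 1 σ f).card, (coveredWith 0 σ f).card, hopt ▸ two_mul_numCovered_le,
    hopt ▸ card_coveredWith_le_numCovered 1, card_coveredWith_one_le_length_twos,
    fun θ D hθ => ⟨(richBins (1 - θ) σ f).card, (blackBins D (1 - θ) σ f).card,
      card_coveredWith_one_le_add θ, Finset.card_le_card richBins_subset,
      Finset.card_le_card blackBins_subset, card_sub_card_mul_le_whiteVolume
        (fun v hv => (hpos v hv).le) (sub_nonneg.2 hθ), fun μ hμ => ?_⟩⟩
  obtain ⟨s, hs0, hs, hcount, hsum⟩ := exists_le_blackCount hpos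
    (A := blackBins D (1 - θ) σ f) (fun j hj => (Finset.mem_filter.1 hj).2) hμ
  have hvolume := card_add_card_sub_card_mul_add_sum_le (f := f) (D := D) (d := 1 - θ) hpos
  exact ⟨s, hs0, hs, hcount, by linarith⟩

theorem exists_threshold (u : List ℝ) {j : ℕ} (hj0 : 0 < j) (hj : j ≤ u.length) :
    ∃ θ ∈ u, j ≤ bigCount θ u ∧ u.countP (fun x => θ < x) < j := by
  obtain ⟨i, -, hle, hlt⟩ := exists_order_statistic (Finset.univ : Finset (Fin u.length))
    (fun i => - u.get i) hj0 (by simpa using hj)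
  refine ⟨u.get i, List.get_mem u i, ?_, ?_⟩
  · rw [bigCount, countP_eq_card]
    simpa using hle
  · rw [countP_eq_card]
    simpa using hlt

/-! ### Rounding to advice values -/

theorem Representable.zero (b : ℕ) : Representable b 0 :=
  ⟨0, by positivity, 0, by positivity, (zero_mul _).symm⟩

theorem exists_representable {b v : ℕ} (hb : 1 ≤ b) (hv : v < 2 ^ (2 ^ b)) :
    ∃ w, Representable b w ∧ w ≤ v ∧ (v : ℝ) ≤ w + v * (2 / 2 ^ b) := by
  by_cases h : v < 2 ^ b
  · exact ⟨v, ⟨v, h, 0, by positivity, by simp⟩, le_rfl, le_add_of_nonneg_right (by positivity)⟩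
  push Not at h
  have hv0 : v ≠ 0 := ((Nat.two_pow_pos b).trans_le h).ne'
  have hbits : b ≤ Nat.log 2 v := Nat.le_log_of_pow_le one_lt_two h
  have hlog : Nat.log 2 v < 2 ^ b := Nat.log_lt_of_lt_pow hv0 hv
  obtain ⟨e, he⟩ : ∃ e, b + e = Nat.log 2 v + 1 := ⟨Nat.log 2 v + 1 - b, by omega⟩
  refine ⟨v / 2 ^ e * 2 ^ e, ⟨v / 2 ^ e, ?_, e, by omega, rfl⟩, Nat.div_mul_le_self _ _, ?_⟩
  · rw [Nat.div_lt_iff_lt_mul (Nat.two_pow_pos e), ← pow_add, he]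
    exact Nat.lt_pow_succ_log_self one_lt_two v
  · have hround : (v : ℝ) ≤ (v / 2 ^ e * 2 ^ e : ℕ) + 2 ^ e := by
      have hdiv := Nat.div_add_mod' v (2 ^ e)
      have := Nat.mod_lt v (Nat.two_pow_pos e)
      exact_mod_cast (by omega : v ≤ v / 2 ^ e * 2 ^ e + 2 ^ e)
    have herror : (2 : ℝ) ^ e ≤ v * (2 / 2 ^ b) := by
      have hlead : (2 : ℝ) ^ Nat.log 2 v ≤ v := by exact_mod_cast Nat.pow_log_le_self 2 hv0
      rw [← mul_div_assoc, le_div_iff₀ (by positivity), ← pow_add, add_comm, he, pow_succ]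
      linarith
    linarith

theorem exists_representable_mul {b v : ℕ} (hb : 1 ≤ b) (hv : v < 2 ^ (2 ^ b)) {q : ℝ}
    (hq0 : 0 ≤ q) (hq1 : q ≤ 1) :
    ∃ w, Representable b w ∧ (w : ℝ) ≤ q * v ∧ q * v ≤ w + (v * (2 / 2 ^ b) + 1) := by
  have hqv : 0 ≤ q * v := by positivity
  have hfloor : ⌊q * v⌋₊ ≤ v :=
    Nat.floor_le_of_le (mul_le_of_le_one_left v.cast_nonneg hq1)
  obtain ⟨w, hw, hle, hge⟩ := exists_representable hb (hfloor.trans_lt hv)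
  refine ⟨w, hw, (Nat.cast_le.2 hle).trans (Nat.floor_le hqv), ?_⟩
  have hlt := Nat.lt_floor_add_one (q * v)
  have hmul : (⌊q * v⌋₊ : ℝ) * (2 / 2 ^ b) ≤ v * (2 / 2 ^ b) := by gcongr
  linarith

theorem exists_fixed_point (b : ℕ) {v : ℝ} (h0 : 0 ≤ v) (h1 : v < 1) :
    ∃ x : ℕ, x < 2 ^ b ∧ v ≤ ((x : ℝ) + 1) / 2 ^ b ∧ ((x : ℝ) + 1) / 2 ^ b ≤ v + 1 / 2 ^ b := by
  have hb : (0 : ℝ) < 2 ^ b := by positivity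
  refine ⟨⌊v * 2 ^ b⌋₊, ?_, ?_, ?_⟩
  · rw [Nat.floor_lt (by positivity), Nat.cast_pow, Nat.cast_ofNat]
    exact mul_lt_of_lt_one_left hb h1
  · rw [le_div_iff₀ hb]
    exact (Nat.lt_floor_add_one _).le
  · rw [add_div, add_le_add_iff_right, div_le_iff₀ hb]
    exact Nat.floor_le (by positivity)

/-! ### Advice on the small items -/

/-- The advice `p` can be written with precision `b`, makes the strategy put small items of total
size at least `1 - θ` into every reserved bin, and leaves small items of total size about `k` for
the separate bins. -/
structure Advice.Supplies (p : Advice) (b : ℕ) (σ : List ℝ) (k : ℕ) (θ : ℝ) : Prop where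
  encodable : p.Encodable b
  ready : p.SmallReady σ (1 - θ)
  le_volume : (k : ℝ) - p.reserved * (2 / 2 ^ b) ≤
    smallVolume σ - 2 * (p.reserved - p.numBlack) * p.dUp - p.numBlack * p.sUp

section SmallAdvice

variable {σ : List ℝ} {b k r M B : ℕ} {θ : ℝ}

theorem exists_supplies_zero (hσ : IsInput σ) (b : ℕ) (hk : (k : ℝ) ≤ smallVolume σ) :
    ∃ p : Advice, p.reserved = 0 ∧ p.Supplies b σ k 1 := by
  refine ⟨⟨false, 0, 0, 0, 0, 0, 0, 0, 0, ((0 : ℕ) + 1) / 2 ^ b, ((0 : ℕ) : ℝ) / 2 ^ b,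
    ((0 : ℕ) + 1) / 2 ^ b⟩, rfl, ?_, ?_, ?_⟩
  · exact ⟨by norm_num, by norm_num, .zero b, .zero b, .zero b, .zero b, .zero b, .zero b,
      ⟨0, Nat.two_pow_pos b, rfl⟩, 0, Nat.two_pow_pos b, rfl, rfl⟩
  · refine ⟨rfl, by positivity, by rw [sub_self]; positivity, by positivity, ?_, le_rfl,
      Nat.zero_le _, ?_⟩
    · simp only [CharP.cast_eq_zero, zero_div]
      positivity
    · rw [sub_self, mul_zero]
      refine List.sum_nonneg fun x hx => ?_
      obtain ⟨v, hv, rfl⟩ := List.mem_map.1 hx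
      exact whiteSize_nonneg le_rfl (hσ v hv).1.le
  · simpa [Advice.numBlack] using hk

/-- About half of the black items of the optimal packing suffice, so that both colours remain
available in twice the required amount. -/
theorem exists_numBlack (hb : 1 ≤ b) (hB : B < 2 ^ (2 ^ b)) (hr : Representable b r) (hBM : B ≤ M)
    (hM : 2 * (r : ℝ) + 2 + 2 * r * (2 / 2 ^ b) ≤ M) :
    ∃ μ, Representable b μ ∧ μ ≤ r ∧ 2 * μ ≤ B ∧ 2 * ((r : ℝ) - μ) ≤ M - B := by
  by_cases hrB : 2 * r ≤ B
  · refine ⟨r, hr, le_rfl, hrB, ?_⟩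
    rw [sub_self, mul_zero, sub_nonneg]
    exact Nat.cast_le.2 hBM
  · obtain ⟨μ, hμ, hle, hge⟩ := exists_representable (v := B / 2) hb (by omega)
    refine ⟨μ, hμ, by omega, by omega, ?_⟩
    have hhalf : (B : ℝ) ≤ 2 * (B / 2 : ℕ) + 1 := by
      exact_mod_cast (by omega : B ≤ 2 * (B / 2) + 1)
    have hmul : ((B / 2 : ℕ) : ℝ) * (2 / 2 ^ b) ≤ r * (2 / 2 ^ b) := by
      gcongr
      omega
    linarith

theorem SmallSupply.exists_supplies {x : ℕ} (hb : 1 ≤ b) (hB : B < 2 ^ (2 ^ b))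
    (hr : Representable b r) (hθ : θ ≤ 1) (hx : x < 2 ^ b) (hxθ : 1 - θ ≤ ((x : ℝ) + 1) / 2 ^ b)
    (hθx : ((x : ℝ) + 1) / 2 ^ b ≤ 1 - θ + 1 / 2 ^ b)
    (hM : 2 * (r : ℝ) + 2 + 2 * r * (2 / 2 ^ b) ≤ M)
    (supply : SmallSupply σ k θ (((x : ℝ) + 1) / 2 ^ b) M B) :
    ∃ p : Advice, p.reserved = r ∧ p.Supplies b σ k θ := by
  obtain ⟨μ, hμ, hμr, hμB, hμM⟩ := exists_numBlack hb hB hr supply.black_le hM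
  obtain ⟨s, hs0, hs, hcount, hvolume⟩ := supply.black μ (by omega)
  obtain ⟨y, hy, hsy, hys⟩ := exists_fixed_point b hs0 (by linarith)
  have hwhite : 2 * ((r : ℝ) - μ) * (1 - θ) ≤ (M - B) * (1 - θ) :=
    mul_le_mul_of_nonneg_right hμM (sub_nonneg.2 hθ)
  set p : Advice := ⟨false, 0, 0, r, 0, 0, 0, μ, μ, ((x : ℝ) + 1) / 2 ^ b, (y : ℝ) / 2 ^ b,
    ((y : ℝ) + 1) / 2 ^ b⟩
  have hblack : p.numBlack = μ := min_eq_left hμr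
  refine ⟨p, rfl, ?_, ?_, ?_⟩
  · exact ⟨by norm_num [p], by norm_num [p], hr, .zero b, .zero b, .zero b, hμ, hμ, ⟨x, hx, rfl⟩,
      y, hy, rfl, rfl⟩
  · exact ⟨rfl, by positivity, hxθ, by positivity, by simp only [p]; gcongr; linarith, hblack.le,
      hblack.trans_le (hcount _ hsy), hblack ▸ hwhite.trans supply.white⟩
  · rw [hblack]
    have hμr : (0 : ℝ) ≤ r - μ := sub_nonneg.2 (Nat.cast_le.2 hμr)
    have hμB : 2 * (μ : ℝ) ≤ B := by exact_mod_cast hμB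
    have hd : 2 * ((r : ℝ) - μ) * p.dUp ≤ 2 * (r - μ) * (1 - θ + 1 / 2 ^ b) :=
      mul_le_mul_of_nonneg_left hθx (by linarith)
    have hsUp : (μ : ℝ) * p.sUp ≤ μ * (s + 1 / 2 ^ b) :=
      mul_le_mul_of_nonneg_left hys μ.cast_nonneg
    have hmulS : (μ : ℝ) * s ≤ (B - μ) * s := mul_le_mul_of_nonneg_right (by linarith) hs0
    have herror : 0 ≤ (μ : ℝ) * (1 / 2 ^ b) := by positivity
    have hsplit : (r : ℝ) * (2 / 2 ^ b) = 2 * ((r - μ) * (1 / 2 ^ b) + μ * (1 / 2 ^ b)) := by ring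
    rw [hsplit]
    linarith

end SmallAdvice

/-! ### The choices of the reserved subsequence -/

/-- With suitable advice of precision `b`, the strategy covers at least `c` bins when it serves
`σ`. -/
def CoversAtLeast (b : ℕ) (σ : List ℝ) (c : ℝ) : Prop :=
  ∃ t : Tape, c ≤ (modifiedDualHarmonic.covered (selfDelimited b t) σ : ℝ)

theorem CoversAtLeast.mono {b : ℕ} {σ : List ℝ} {c c' : ℝ} (h : CoversAtLeast b σ c)
    (hc : c' ≤ c) : CoversAtLeast b σ c' :=
  h.imp fun _ => hc.trans

/-- The advice `p` with other values for the treatment of the 2-items. -/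
def Advice.withTwos (p : Advice) (part variant good L R : ℕ) : Advice :=
  { p with part := part, variant := variant, good := good, chunkL := L, chunkR := R }

namespace Advice.Supplies

variable {p : Advice} {b k : ℕ} {σ : List ℝ} {θ : ℝ}

theorem withTwos (supplies : p.Supplies b σ k θ) {part variant good L R : ℕ} (hpart : part < 4)
    (hvariant : variant < 4) (hgood : Representable b good) (hL : Representable b L)
    (hR : Representable b R) : (p.withTwos part variant good L R).Supplies b σ k θ where
  encodable :=
    { supplies.encodable with
      part_lt := hpart, variant_lt := hvariant, good := hgood, chunkL := hL, chunkR := hR }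
  ready := ⟨supplies.ready.plain, supplies.ready.dUp_pos, supplies.ready.le_dUp,
    supplies.ready.sUp_nonneg, supplies.ready.sDown_le, supplies.ready.numBlack_le_extra,
    supplies.ready.numBlack_le_count, supplies.ready.le_whiteVolume⟩
  le_volume := supplies.le_volume

theorem coversAtLeast (supplies : p.Supplies b σ k θ) (hσ : IsInput σ) {a e T m l : ℕ}
    (S : p.Schedule (twos σ).length a e T) (he : e ≤ (twos σ).length)
    (hg : prefixCount θ (twos σ) a + p.declared ≤ prefixCount θ (twos σ) e)
    (hmT : m ≤ min (twos σ).length T - e) (hm : m ≤ e - a - p.declared)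
    (hl : l = min (p.reserved - (e - a)) ((twos σ).length - T)) :
    CoversAtLeast b σ ((twos σ).length / 2 + (p.declared + ((m : ℝ) - (e - a) - l) / 2 +
      (prefixCount θ (twos σ) (T + l) - prefixCount θ (twos σ) T)) - 1 / 2 +
      2 / 3 * (k - p.reserved * (2 / 2 ^ b) - 1)) := by
  obtain ⟨t, ht⟩ := supplies.encodable.exists_decode_eq
  obtain rfl : readAdvice (selfDelimited b t) = p := (readAdvice_selfDelimited b t).trans ht
  refine ⟨t, le_trans ?_ (supplies.ready.le_covered S hσ he hg hmT hm hl)⟩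
  have := supplies.le_volume
  linarith

theorem coversAtLeast_window (supplies : p.Supplies b σ k θ) (hσ : IsInput σ)
    (hN : 4 * p.reserved ≤ (twos σ).length) {q good : ℕ} (hq : q < 3)
    (hgood : Representable b good)
    (hg : prefixCount θ (twos σ) (q * p.reserved) + (good - 1) ≤
      prefixCount θ (twos σ) ((q + 1) * p.reserved)) :
    CoversAtLeast b σ ((twos σ).length / 2 + ((good - 1 : ℕ) : ℝ) / 2 - 1 / 2 +
      2 / 3 * (k - p.reserved * (2 / 2 ^ b) - 1)) := by
  have hlength : (q + 1) * p.reserved = q * p.reserved + p.reserved := Nat.succ_mul _ _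
  have hstart : q * p.reserved ≤ 2 * p.reserved := Nat.mul_le_mul_right _ (by omega)
  have hgr := prefixCount_le θ (twos σ) (Nat.le_add_right (q * p.reserved) p.reserved)
  rw [Nat.add_sub_cancel_left, ← hlength] at hgr
  have S : (p.withTwos q 0 good 0 0).Schedule (twos σ).length (q * p.reserved)
      ((q + 1) * p.reserved) (twos σ).length :=
    ⟨by simp [fillStart, Advice.withTwos, hq], by simp [fillEnd, Advice.withTwos, hq],
      fun i hi => by simp [resume, Advice.withTwos, hq, hi], by omega, by omega,
      by simp only [Advice.withTwos]; omega⟩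
  have hdeclared : (p.withTwos q 0 good 0 0).declared = good - 1 := by
    simp [declared, Advice.withTwos]
  generalize good - 1 = g at hg hdeclared ⊢
  refine ((supplies.withTwos (by omega) (by norm_num) hgood (.zero b) (.zero b)).coversAtLeast hσ S
    (m := p.reserved - g) (l := 0) (by omega) (by omega) (by omega) (by omega)
    (by simp)).mono ?_
  rw [hdeclared, Nat.cast_sub (by omega), hlength, Nat.add_zero, sub_self]
  simp only [Advice.withTwos]
  push_cast
  linarith

theorem coversAtLeast_first_chunks (supplies : p.Supplies b σ k θ) (hσ : IsInput σ)
    (hN : 4 * p.reserved ≤ (twos σ).length) {good L R : ℕ} {c : ℝ} (hgood : Representable b good)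
    (hL : Representable b L) (hR : Representable b R) (hLR : L + R ≤ p.reserved)
    (hg : prefixCount θ (twos σ) (3 * p.reserved) + (good - 1) ≤
      prefixCount θ (twos σ) (3 * p.reserved + L + R))
    (hc : c ≤ (good - 1 : ℕ) / 2)
    (hcN : c ≤ (good - 1 : ℕ) + ((twos σ).length - 5 * p.reserved) / 2) :
    CoversAtLeast b σ ((twos σ).length / 2 + c - 1 / 2 +
      2 / 3 * (k - p.reserved * (2 / 2 ^ b) - 1)) := by
  have hgr := prefixCount_le θ (twos σ) (by omega : 3 * p.reserved ≤ 3 * p.reserved + L + R)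
  have S : (p.withTwos 3 0 good L R).Schedule (twos σ).length (3 * p.reserved)
      (3 * p.reserved + L + R) (twos σ).length :=
    ⟨by simp [fillStart, Advice.withTwos], by simp [fillEnd, Advice.withTwos],
      fun i hi => by simp [resume, Advice.withTwos, hi], by omega, by omega,
      by simp only [Advice.withTwos]; omega⟩
  have hdeclared : (p.withTwos 3 0 good L R).declared = good - 1 := by
    simp [declared, Advice.withTwos]
  generalize good - 1 = g at hg hdeclared hc hcN
  refine ((supplies.withTwos (by norm_num) (by norm_num) hgood hL hR).coversAtLeast hσ S
    (m := min ((twos σ).length - (3 * p.reserved + L + R)) (L + R - g)) (l := 0)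
    (by omega) (by omega) (by omega) (by omega) (by simp)).mono ?_
  have hLR' : (L : ℝ) + R ≤ p.reserved := by exact_mod_cast hLR
  rw [hdeclared, Nat.cast_min, Nat.cast_sub (by omega), Nat.cast_sub (by omega), Nat.add_zero,
    sub_self]
  simp only [Advice.withTwos]
  push_cast
  rcases min_choice ((twos σ).length - (3 * p.reserved + L + R) : ℝ) (L + R - g) with h | h <;>
    rw [h] <;> linarith

theorem coversAtLeast_outer_chunks (supplies : p.Supplies b σ k θ) (hσ : IsInput σ)
    (hN : 4 * p.reserved ≤ (twos σ).length) {g L R l : ℕ} (hrep : Representable b g)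
    (hL : Representable b L) (hR : Representable b R) (hLR : L + R ≤ p.reserved)
    (hgR : L ≤ g + R)
    (hg : prefixCount θ (twos σ) (3 * p.reserved) + g ≤
      prefixCount θ (twos σ) (3 * p.reserved + L))
    (hl : l = min (p.reserved - L) ((twos σ).length - (3 * p.reserved + L + R))) :
    CoversAtLeast b σ ((twos σ).length / 2 + ((g : ℝ) / 2 +
      (prefixCount θ (twos σ) (3 * p.reserved + L + R + l) -
        prefixCount θ (twos σ) (3 * p.reserved + L + R)) - l / 2) - 1 / 2 +
      2 / 3 * (k - p.reserved * (2 / 2 ^ b) - 1)) := by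
  have hgL := prefixCount_le θ (twos σ) (by omega : 3 * p.reserved ≤ 3 * p.reserved + L)
  have S : (p.withTwos 3 1 g L R).Schedule (twos σ).length (3 * p.reserved)
      (3 * p.reserved + L) (3 * p.reserved + L + R) :=
    ⟨by simp [fillStart, Advice.withTwos], by simp [fillEnd, Advice.withTwos],
      fun i _ => by
        simp only [resume, Advice.withTwos, lt_irrefl, if_false, one_ne_zero, if_true,
          Nat.cast_le],
      by omega, by omega, by simp only [Advice.withTwos]; omega⟩
  have hdeclared : (p.withTwos 3 1 g L R).declared = g := by simp [declared, Advice.withTwos]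
  refine ((supplies.withTwos (by norm_num) (by norm_num) hrep hL hR).coversAtLeast hσ S
    (m := L - g) (l := l) (by omega) (by omega) (by omega) (by omega)
    (by simp only [Advice.withTwos]; omega)).mono ?_
  rw [hdeclared, Nat.cast_sub (by omega)]
  simp only [Advice.withTwos]
  push_cast
  linarith

theorem coversAtLeast_last_chunks (supplies : p.Supplies b σ k θ) (hσ : IsInput σ)
    (hN : 4 * p.reserved ≤ (twos σ).length) {L l : ℕ} (hL : Representable b L)
    (hLr : L ≤ p.reserved) (hl : l = min p.reserved ((twos σ).length - (3 * p.reserved + L))) :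
    CoversAtLeast b σ ((twos σ).length / 2 +
      ((prefixCount θ (twos σ) (3 * p.reserved + L + l) : ℝ) -
        prefixCount θ (twos σ) (3 * p.reserved + L) - l / 2) - 1 / 2 +
      2 / 3 * (k - p.reserved * (2 / 2 ^ b) - 1)) := by
  have S : (p.withTwos 3 2 0 L 0).Schedule (twos σ).length (3 * p.reserved + L)
      (3 * p.reserved + L) (3 * p.reserved + L) :=
    ⟨by simp [fillStart, Advice.withTwos], by simp [fillEnd, Advice.withTwos],
      fun i _ => by
        simp only [resume, Advice.withTwos, lt_irrefl, if_false, OfNat.ofNat_ne_zero,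
          OfNat.ofNat_ne_one, Nat.cast_le],
      le_rfl, le_rfl, by simp⟩
  have hdeclared : (p.withTwos 3 2 0 L 0).declared = 0 := by simp [declared, Advice.withTwos]
  refine ((supplies.withTwos (by norm_num) (by norm_num) (.zero b) hL (.zero b)).coversAtLeast hσ S
    (m := 0) (l := l) (by omega) (by omega) (by omega) (by omega)
    (by simp only [Advice.withTwos]; omega)).mono ?_
  rw [hdeclared]
  simp only [Advice.withTwos]
  push_cast
  linarith

end Advice.Supplies

theorem coversAtLeast_of_le_smallVolume {σ : List ℝ} (hσ : IsInput σ) (b : ℕ) {k : ℕ}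
    (hk : (k : ℝ) ≤ smallVolume σ) :
    CoversAtLeast b σ ((twos σ).length / 2 - 1 / 2 + 2 / 3 * ((k : ℝ) - 1)) := by
  obtain ⟨p, hr, supplies⟩ := exists_supplies_zero hσ b hk
  refine (supplies.coversAtLeast_window hσ (by omega) (q := 0) (by norm_num) (.zero b)
    (by simp [hr])).mono ?_
  rw [hr]
  push_cast
  linarith

/-! ### Calibration and counting of the large 2-items -/

/-- A bound for the error when numbers up to `m` are rounded, first to an integer and then to an
advice value of precision `b`. -/
noncomputable def roundingError (b m : ℕ) : ℝ := m * (2 / 2 ^ b) + 1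

/-- Twice the number of bins that are to be covered in addition to `N / 2`, when the optimal packing
covers `m` bins with one 2-item each and `(N - m) / 2` bins with two. -/
noncomputable def surplus (m N : ℕ) : ℝ := 135 / 242 * ((m : ℝ) + N) - N

/-- The values used for the number of reserved bins and for the lengths of the first two chunks,
when the optimal packing covers `m` bins with one 2-item each: they are proportional to 27, 14 and
13, up to rounding. -/
structure Calibrated (b m r L R : ℕ) : Prop where
  le_reserved : 27 / 121 * (m : ℝ) - roundingError b m ≤ r
  reserved_le : (r : ℝ) ≤ 27 / 121 * m
  le_left : 14 / 27 * (r : ℝ) - roundingError b m ≤ L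
  left_le : (L : ℝ) ≤ 14 / 27 * r
  le_right : 13 / 27 * (r : ℝ) - roundingError b m ≤ R
  right_le : (R : ℝ) ≤ 13 / 27 * r

theorem one_le_roundingError (b m : ℕ) : 1 ≤ roundingError b m :=
  le_add_of_nonneg_left (by positivity)

theorem add_one_le_roundingError (b : ℕ) {v m : ℕ} (hv : v ≤ m) :
    v * (2 / 2 ^ b) + 1 ≤ roundingError b m := by
  unfold roundingError
  gcongr

section Calibration

variable {b m : ℕ}

theorem exists_representable_le (hb : 1 ≤ b) (hm : m < 2 ^ (2 ^ b)) {v : ℕ} (hv : v ≤ m) :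
    ∃ w, Representable b w ∧ w ≤ v ∧ (v : ℝ) + 1 ≤ w + roundingError b m := by
  obtain ⟨w, hw, hwv, hvw⟩ := exists_representable hb (hv.trans_lt hm)
  have := add_one_le_roundingError b hv
  exact ⟨w, hw, hwv, by linarith⟩

theorem exists_calibrated (hb : 1 ≤ b) (hm : m < 2 ^ (2 ^ b)) : ∃ r L R, Representable b r ∧
    Representable b L ∧ Representable b R ∧ Calibrated b m r L R := by
  obtain ⟨r, hr, hrm, hmr⟩ :=
    exists_representable_mul hb hm (q := 27 / 121) (by norm_num) (by norm_num)
  have hle : r ≤ m := by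
    rify
    linarith [m.cast_nonneg (α := ℝ)]
  obtain ⟨L, hL, hLr, hrL⟩ := exists_representable_mul hb (hle.trans_lt hm) (q := 14 / 27)
    (by norm_num) (by norm_num)
  obtain ⟨R, hR, hRr, hrR⟩ := exists_representable_mul hb (hle.trans_lt hm) (q := 13 / 27)
    (by norm_num) (by norm_num)
  have := add_one_le_roundingError b hle
  refine ⟨r, L, R, hr, hL, hR, ?_, hrm, ?_, hLr, ?_, hRr⟩
  · rw [roundingError]
    linarith
  · linarith
  · linarith

variable {u : List ℝ} {θ : ℝ} {a e : ℕ}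

theorem exists_good_le_prefixCount_sub (hb : 1 ≤ b) (hm : m < 2 ^ (2 ^ b)) (hae : a ≤ e)
    (hem : e - a ≤ m) : ∃ g, Representable b g ∧ prefixCount θ u a + g ≤ prefixCount θ u e ∧
      (prefixCount θ u e : ℝ) - prefixCount θ u a ≤ g + roundingError b m := by
  have hmono := prefixCount_mono θ u hae
  have hle := prefixCount_le θ u hae
  obtain ⟨g, hg, hgle, hleg⟩ := exists_representable_le hb hm
    (by omega : prefixCount θ u e - prefixCount θ u a ≤ m)
  rw [Nat.cast_sub hmono] at hleg
  exact ⟨g, hg, by omega, by linarith⟩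

theorem exists_good_sub_one_le_prefixCount_sub (hb : 1 ≤ b) (hm : m < 2 ^ (2 ^ b)) (hae : a ≤ e)
    (hem : e - a < m) :
    ∃ good, Representable b good ∧ prefixCount θ u a + (good - 1) ≤ prefixCount θ u e ∧
      (prefixCount θ u e : ℝ) - prefixCount θ u a ≤ (good - 1 : ℕ) + roundingError b m := by
  have hmono := prefixCount_mono θ u hae
  have hle := prefixCount_le θ u hae
  obtain ⟨good, hgood, hgle, hleg⟩ := exists_representable_le hb hm
    (by omega : prefixCount θ u e - prefixCount θ u a + 1 ≤ m)
  have hpred : (good : ℝ) ≤ (good - 1 : ℕ) + 1 := by exact_mod_cast le_tsub_add (a := 1) (b := good)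
  push_cast [Nat.cast_sub hmono] at hleg
  exact ⟨good, hgood, by omega, by linarith⟩

end Calibration

namespace Calibrated

variable {b m r L R : ℕ}

theorem four_mul_reserved_le (cal : Calibrated b m r L R) : 4 * r ≤ m := by
  rify
  linarith [cal.reserved_le, m.cast_nonneg (α := ℝ)]

theorem left_add_right_le (cal : Calibrated b m r L R) : L + R ≤ r := by
  rify
  linarith [cal.left_le, cal.right_le]

theorem le_last_length (cal : Calibrated b m r L R) {N l : ℕ} (hmN : m ≤ N)
    (hl : l = min r (N - (3 * r + L))) : 26 / 121 * (m : ℝ) - roundingError b m ≤ l := by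
  have h4r := cal.four_mul_reserved_le
  have hLR := cal.left_add_right_le
  have hmN' : (m : ℝ) ≤ N := Nat.cast_le.2 hmN
  rw [hl, Nat.cast_min, Nat.cast_sub (by omega)]
  push_cast
  refine le_min ?_ ?_
  · linarith [cal.le_reserved, m.cast_nonneg (α := ℝ)]
  · linarith [cal.reserved_le, cal.left_le, one_le_roundingError b m]

theorem le_outer_length (cal : Calibrated b m r L R) {N l : ℕ} (hmN : m ≤ N)
    (hl : l = min (r - L) (N - (3 * r + L + R))) :
    13 / 121 * (m : ℝ) - roundingError b m ≤ l := by
  have h4r := cal.four_mul_reserved_le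
  have hLR := cal.left_add_right_le
  have hmN' : (m : ℝ) ≤ N := Nat.cast_le.2 hmN
  have hE := one_le_roundingError b m
  rw [hl, Nat.cast_min, Nat.cast_sub (by omega), Nat.cast_sub (by omega)]
  push_cast
  refine le_min ?_ ?_
  · linarith [cal.le_reserved, cal.left_le]
  · linarith [cal.reserved_le, cal.left_le, cal.right_le]

/-- Up to rounding and in units of `m / 121`, when `N = m`: the reserved bins number 27, the three
chunks have lengths 14, 13 and 13, and at least 67 of the 2-items are large. -/
theorem exists_large_gain (cal : Calibrated b m r L R) {u : List ℝ} {θ : ℝ} {l l' : ℕ}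
    (hmu : m ≤ u.length) (hG : 1000 * roundingError b m < surplus m u.length)
    (hlarge : (m : ℝ) - 2 * r - 3 * roundingError b m ≤ prefixCount θ u u.length)
    (hl : l = min r (u.length - (3 * r + L)))
    (hl' : l' = min (r - L) (u.length - (3 * r + L + R))) :
    (∃ q < 3, surplus m u.length - 15 * roundingError b m ≤
      prefixCount θ u ((q + 1) * r) - prefixCount θ u (q * r)) ∨
    surplus m u.length - 15 * roundingError b m ≤
      prefixCount θ u (3 * r + L + R) - prefixCount θ u (3 * r) ∨
    surplus m u.length - 15 * roundingError b m ≤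
      2 * ((prefixCount θ u (3 * r + L + l) : ℝ) - prefixCount θ u (3 * r + L)) - l ∨
    L + 2 * roundingError b m ≤ prefixCount θ u (3 * r + L) - prefixCount θ u (3 * r) + R ∧
    surplus m u.length - 15 * roundingError b m ≤
      prefixCount θ u (3 * r + L) - prefixCount θ u (3 * r) +
        2 * ((prefixCount θ u (3 * r + L + R + l') : ℝ) -
          prefixCount θ u (3 * r + L + R)) - l' := by
  have h4r := cal.four_mul_reserved_le
  have hLR := cal.left_add_right_le
  have hmu' : (m : ℝ) ≤ u.length := Nat.cast_le.2 hmu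
  have hE := one_le_roundingError b m
  have hlm := cal.le_last_length hmu hl
  have hlm' := cal.le_outer_length hmu hl'
  have hrest := prefixCount_le θ u (by omega : 3 * r + L + l ≤ u.length)
  have hrest' := prefixCount_le θ u (by omega : 3 * r + L + R + l' ≤ u.length)
  rify [show 3 * r + L + l ≤ u.length by omega] at hrest
  rify [show 3 * r + L + R + l' ≤ u.length by omega] at hrest'
  obtain ⟨hr, -, hL, -, hR, -⟩ := cal
  unfold surplus at *
  by_contra! h
  obtain ⟨hwindow, hfirst, hlast, houter⟩ := h
  have h₀ := hwindow 0 (by norm_num)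
  have h₁ := hwindow 1 (by norm_num)
  have h₂ := hwindow 2 (by norm_num)
  simp only [zero_add, one_mul, zero_mul, Nat.reduceAdd] at h₀ h₁ h₂
  have hzero : prefixCount θ u 0 = 0 := by simp [prefixCount, bigCount]
  rw [hzero, Nat.cast_zero, sub_zero] at h₀
  set a : ℝ := prefixCount θ u (3 * r + L) - prefixCount θ u (3 * r) with ha
  set c : ℝ := prefixCount θ u (3 * r + L + R) - prefixCount θ u (3 * r + L) with hc
  set d : ℝ := prefixCount θ u u.length - prefixCount θ u (3 * r + L + R) with hd
  have hacd : (m : ℝ) - 2 * r - 3 * (135 / 242 * (m + u.length) - u.length) +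
      42 * roundingError b m ≤ a + c + d := by linarith [ha, hc, hd]
  have hac : a + c < 135 / 242 * (m + u.length) - u.length - 15 * roundingError b m := by linarith
  have hcd : 2 * (c + d) < 135 / 242 * (m + u.length) - u.length - 15 * roundingError b m +
      (2 * (u.length - (3 * r + L)) - l) := by linarith
  have had : a + 2 * d < 135 / 242 * (m + u.length) - u.length - 15 * roundingError b m +
      (2 * (u.length - (3 * r + L + R)) - l') := by
    have := houter (by linarith)
    linarith
  have hsum : 3 * (a + c + d) = 2 * (a + c) + (c + d) + (a + 2 * d) := by ring
  linarith [hacd, hac, hcd, had, hsum]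

end Calibrated

theorem Advice.Supplies.coversAtLeast_surplus {p : Advice} {σ : List ℝ} {b m k L R : ℕ} {θ : ℝ}
    (supplies : p.Supplies b σ k θ) (hσ : IsInput σ) (hb : 1 ≤ b) (hm : m < 2 ^ (2 ^ b))
    (cal : Calibrated b m p.reserved L R) (hL : Representable b L) (hR : Representable b R)
    (hmN : m ≤ (twos σ).length) (hG : 1000 * roundingError b m < surplus m (twos σ).length)
    (hlarge : (m : ℝ) - 2 * p.reserved - 3 * roundingError b m ≤
      prefixCount θ (twos σ) (twos σ).length) :
    CoversAtLeast b σ ((twos σ).length / 2 + surplus m (twos σ).length / 2 + 2 / 3 * k -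
      20 * roundingError b m) := by
  have h4r := cal.four_mul_reserved_le
  have h4N := h4r.trans hmN
  have hLR := cal.left_add_right_le
  have hrε := add_one_le_roundingError b (by omega : p.reserved ≤ m)
  have hE := one_le_roundingError b m
  have hrm : p.reserved < m := by
    rify
    unfold surplus at hG
    linarith [cal.reserved_le, (Nat.cast_le (α := ℝ)).2 hmN]
  have enough : ∀ c : ℝ, surplus m (twos σ).length / 2 - 16 * roundingError b m ≤ c →
      (twos σ).length / 2 + surplus m (twos σ).length / 2 + 2 / 3 * k - 20 * roundingError b m ≤
        (twos σ).length / 2 + c - 1 / 2 + 2 / 3 * (k - p.reserved * (2 / 2 ^ b) - 1) :=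
    fun c hc => by linarith
  rcases cal.exists_large_gain hmN hG hlarge rfl rfl with ⟨q, hq, h⟩ | h | h | ⟨hmatch, h⟩
  · have hwidth : (q + 1) * p.reserved = q * p.reserved + p.reserved := Nat.succ_mul _ _
    obtain ⟨good, hgood, hle, hge⟩ := exists_good_sub_one_le_prefixCount_sub (u := twos σ)
      (θ := θ) hb hm (by omega : q * p.reserved ≤ (q + 1) * p.reserved) (by omega)
    exact (supplies.coversAtLeast_window hσ h4N hq hgood hle).mono (enough _ (by linarith))
  · obtain ⟨good, hgood, hle, hge⟩ := exists_good_sub_one_le_prefixCount_sub (u := twos σ)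
      (θ := θ) hb hm (by omega : 3 * p.reserved ≤ 3 * p.reserved + L + R) (by omega)
    refine (supplies.coversAtLeast_first_chunks hσ h4N hgood hL hR hLR hle (by linarith) ?_).mono
      (enough _ le_rfl)
    have hmN' : (m : ℝ) ≤ (twos σ).length := Nat.cast_le.2 hmN
    unfold surplus at *
    linarith [cal.reserved_le]
  · exact (supplies.coversAtLeast_last_chunks hσ h4N hL (by omega) rfl).mono
      (enough _ (by linarith))
  · obtain ⟨g, hg, hle, hge⟩ := exists_good_le_prefixCount_sub (u := twos σ)
      (θ := θ) hb hm (by omega : 3 * p.reserved ≤ 3 * p.reserved + L) (by omega)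
    have hmatched : L ≤ g + R := by
      rify
      linarith
    exact (supplies.coversAtLeast_outer_chunks hσ h4N hg hL hR hLR hmatched hle rfl).mono
      (enough _ (by linarith))

/-! ### The number of covered bins -/

/-- The large 2-items are taken to be the `m - 2 r` largest ones, up to rounding, so that at least
`2 r` bins of the optimal packing contain one 2-item that is not larger. -/
theorem exists_supplies_le_prefixCount {σ : List ℝ} {b m k r : ℕ} (hσ : IsInput σ)
    (hb : 1 ≤ b) (hm : m < 2 ^ (2 ^ b)) (hr : Representable b r) (hrm : (r : ℝ) ≤ 27 / 121 * m)
    (hE : 1000 * roundingError b m < m) (hmN : m ≤ (twos σ).length)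
    (hsupply : ∀ θ D : ℝ, θ ≤ 1 → ∃ M B : ℕ, m ≤ M + (twos σ).countP (fun x => θ < x) ∧ M ≤ m ∧
      SmallSupply σ k θ D M B) :
    ∃ (p : Advice) (θ : ℝ), p.reserved = r ∧ p.Supplies b σ k θ ∧
      (m : ℝ) - 2 * r - 3 * roundingError b m ≤ prefixCount θ (twos σ) (twos σ).length := by
  have hle : r ≤ m := by
    rify
    linarith [m.cast_nonneg (α := ℝ)]
  have hrε := add_one_le_roundingError b hle
  have hr0 : 0 ≤ r * (2 / (2 : ℝ) ^ b) := by positivity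
  have := one_le_roundingError b m
  set j := ⌊(m : ℝ) - 2 * r - 2 - 2 * r * (2 / 2 ^ b)⌋₊
  have hj : (j : ℝ) ≤ m - 2 * r - 2 - 2 * r * (2 / 2 ^ b) := Nat.floor_le (by linarith)
  have hj' := Nat.lt_floor_add_one ((m : ℝ) - 2 * r - 2 - 2 * r * (2 / 2 ^ b))
  have hjm : j ≤ m := by
    rify
    linarith [r.cast_nonneg (α := ℝ)]
  obtain ⟨θ, hθ, hjθ, hθj⟩ :=
    exists_threshold (twos σ) (Nat.floor_pos.2 (by linarith) : 0 < j) (hjm.trans hmN)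
  obtain ⟨hθσ, hθ_half⟩ := List.mem_filter.1 hθ
  have hθ1 : θ < 1 := (hσ θ hθσ).2
  have hθ0 : 1 / 2 ≤ θ := by simpa using hθ_half
  obtain ⟨x, hx, hxθ, hθx⟩ :=
    exists_fixed_point b (by linarith : 0 ≤ 1 - θ) (by linarith)
  obtain ⟨M, B, hmM, hMm, supply⟩ := hsupply θ (((x : ℝ) + 1) / 2 ^ b) hθ1.le
  have hM : 2 * (r : ℝ) + 2 + 2 * r * (2 / 2 ^ b) ≤ M := by
    have hmMj : (m : ℝ) ≤ M + j := by exact_mod_cast hmM.trans (by omega)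
    linarith
  obtain ⟨p, hp, supplies⟩ := supply.exists_supplies hb
    ((supply.black_le.trans hMm).trans_lt hm) hr hθ1.le hx hxθ hθx hM
  refine ⟨p, θ, hp, supplies, ?_⟩
  rw [prefixCount, List.take_length]
  have hjθ' : (j : ℝ) ≤ bigCount θ (twos σ) := Nat.cast_le.2 hjθ
  linarith

theorem coversAtLeast_opt {σ : List ℝ} (hσ : IsInput σ) {b : ℕ} (hb : 1 ≤ b)
    (hn : σ.length < 2 ^ (2 ^ b)) :
    CoversAtLeast b σ (135 / 242 * (opt σ : ℝ) - 600 * (opt σ * (2 / 2 ^ b) + 1)) := by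
  obtain ⟨m, k, hopt, hmopt, hmN, hsupply⟩ := exists_smallSupply hσ
  have hm : m < 2 ^ (2 ^ b) := (hmN.trans (List.length_filter_le _ _)).trans_lt hn
  have hopt' : 2 * (opt σ : ℝ) ≤ (twos σ).length + m + 2 * k := by exact_mod_cast hopt
  have hmN' : (m : ℝ) ≤ (twos σ).length := Nat.cast_le.2 hmN
  have hE : roundingError b m ≤ opt σ * (2 / 2 ^ b) + 1 := by
    unfold roundingError
    gcongr
  have hE1 := one_le_roundingError b m
  have := k.cast_nonneg (α := ℝ)
  rcases le_or_gt (surplus m (twos σ).length) (1000 * roundingError b m) with hG | hG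
  · obtain ⟨M, B, -, -, supply⟩ := hsupply 1 0 le_rfl
    refine (coversAtLeast_of_le_smallVolume hσ b (supply.le_smallVolume le_rfl)).mono ?_
    unfold surplus at hG
    linarith
  · have hEm : 1000 * roundingError b m < m := by
      unfold surplus at hG
      linarith
    obtain ⟨r, L, R, hr, hL, hR, cal⟩ := exists_calibrated hb hm
    obtain ⟨p, θ, rfl, supplies, hlarge⟩ :=
      exists_supplies_le_prefixCount hσ hb hm hr cal.reserved_le hEm hmN hsupply
    refine (supplies.coversAtLeast_surplus hσ hb hm cal hL hR hmN hG hlarge).mono ?_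
    unfold surplus
    linarith

/-! ### The choice of the precision -/

theorem opt_le_length (σ : List ℝ) : opt σ ≤ σ.length :=
  Finset.sup_le fun _ _ => (Finset.card_le_univ _).trans_eq (Fintype.card_fin _)

theorem one_lt_logb {n : ℕ} (hn : 3 ≤ n) : 1 < Real.logb 2 n := by
  have hn' : (3 : ℝ) ≤ n := Nat.ofNat_le_cast.2 hn
  rw [Real.lt_logb_iff_rpow_lt one_lt_two (by linarith), Real.rpow_one]
  linarith

theorem sq_logb_le_two_pow_approxBits {n : ℕ} (hn : 3 ≤ n) :
    Real.logb 2 n ^ 2 ≤ 2 ^ approxBits n := by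
  have hlog := one_lt_logb hn
  calc Real.logb 2 n ^ 2 = (2 : ℝ) ^ (2 * Real.logb 2 (Real.logb 2 n)) := by
        rw [mul_comm, Real.rpow_mul zero_le_two,
          Real.rpow_logb two_pos one_lt_two.ne' (by linarith), Real.rpow_two]
    _ ≤ (2 : ℝ) ^ (approxBits n : ℝ) :=
        Real.rpow_le_rpow_of_exponent_le one_le_two (Nat.le_ceil _)
    _ = 2 ^ approxBits n := Real.rpow_natCast _ _

theorem logb_lt_two_pow_approxBits {n : ℕ} (hn : 3 ≤ n) :
    Real.logb 2 n < 2 ^ approxBits n :=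
  (lt_self_pow₀ (one_lt_logb hn) one_lt_two).trans_le (sq_logb_le_two_pow_approxBits hn)

theorem one_le_approxBits {n : ℕ} (hn : 3 ≤ n) : 1 ≤ approxBits n := by
  have h : (1 : ℝ) < 2 ^ approxBits n := (one_lt_logb hn).trans (logb_lt_two_pow_approxBits hn)
  exact Nat.one_le_iff_ne_zero.2 fun h0 => by simp [h0] at h

theorem lt_two_pow_two_pow_approxBits {n : ℕ} (hn : 3 ≤ n) : n < 2 ^ (2 ^ approxBits n) := by
  have h := logb_lt_two_pow_approxBits hn
  rw [Real.logb_lt_iff_lt_rpow one_lt_two (Nat.cast_pos.2 (by omega))] at h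
  exact_mod_cast h

theorem coversAtLeast_approxBits {σ : List ℝ} (hσ : IsInput σ) :
    CoversAtLeast (approxBits σ.length) σ
      ((135 / 242 - 1200 / 2 ^ approxBits σ.length) * opt σ - 600) := by
  rcases le_or_gt 3 σ.length with hn | hn
  · exact (coversAtLeast_opt hσ (one_le_approxBits hn) (lt_two_pow_two_pow_approxBits hn)).mono
      (le_of_eq (by ring))
  · have hopt : (opt σ : ℝ) ≤ 2 := by
      exact_mod_cast (opt_le_length σ).trans (Nat.le_of_lt_succ hn)
    have herr : 0 ≤ 1200 / (2 : ℝ) ^ approxBits σ.length * opt σ := by positivity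
    refine ⟨fun _ => false, le_trans ?_ (Nat.cast_nonneg _)⟩
    rw [sub_mul]
    linarith

theorem isBigO_adviceBits : (fun n : ℕ => ((15 * approxBits n + 6 : ℕ) : ℝ)) =O[atTop]
    fun n : ℕ => Real.logb 2 (Real.logb 2 (n : ℝ)) := by
  refine IsBigO.of_bound 51 ?_
  filter_upwards [eventually_ge_atTop 4] with n hn
  have hn' : (4 : ℝ) ≤ n := Nat.ofNat_le_cast.2 hn
  have hlog : 2 ≤ Real.logb 2 n := by
    rw [Real.le_logb_iff_rpow_le one_lt_two (by linarith)]
    norm_num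
    linarith
  have hloglog : 1 ≤ Real.logb 2 (Real.logb 2 n) := by
    rwa [Real.le_logb_iff_rpow_le one_lt_two (by linarith), Real.rpow_one]
  have hceil : (approxBits n : ℝ) < 2 * Real.logb 2 (Real.logb 2 n) + 1 :=
    Nat.ceil_lt_add_one (by linarith)
  rw [Real.norm_of_nonneg (by positivity), Real.norm_of_nonneg (by linarith)]
  push_cast
  linarith

theorem isBigO_div_two_pow_approxBits (c : ℝ) :
    (fun n : ℕ => c / (2 : ℝ) ^ approxBits n) =O[atTop] fun n : ℕ => 1 / Real.logb 2 (n : ℝ) := by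
  refine IsBigO.of_bound ‖c‖ ?_
  filter_upwards [eventually_ge_atTop 3] with n hn
  have hlog := one_lt_logb hn
  have hpow := logb_lt_two_pow_approxBits hn
  rw [norm_div, norm_pow, Real.norm_two,
    Real.norm_of_nonneg (one_div_nonneg.2 (zero_le_one.trans hlog.le)), mul_one_div]
  gcongr

end BinCovering

/-- The modified Dual Harmonic strategy with `b = 2 log log n` uses `O(log log n)` advice bits and
has asymptotic competitive ratio at least `135/242 - O(1 / log n)`. -/
theorem theorem1 :
    ∃ (adviceBits : ℕ → ℕ) (err : ℕ → ℝ) (C : ℝ),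
      (fun n : ℕ => (adviceBits n : ℝ)) =O[Filter.atTop]
        (fun n : ℕ => Real.logb 2 (Real.logb 2 (n : ℝ))) ∧
      err =O[Filter.atTop] (fun n : ℕ => 1 / Real.logb 2 (n : ℝ)) ∧
      ∀ σ : List ℝ, BinCovering.IsInput σ →
        ∃ t : BinCovering.Tape,
          BinCovering.modifiedDualHarmonic.bitsRead
              (BinCovering.selfDelimited (BinCovering.approxBits σ.length) t) σ
            ≤ (adviceBits σ.length : ℕ∞) ∧
          (135 / 242 - err σ.length) * (BinCovering.opt σ : ℝ) - C
            ≤ (BinCovering.modifiedDualHarmonic.covered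
                (BinCovering.selfDelimited (BinCovering.approxBits σ.length) t) σ : ℝ) := by
  refine ⟨fun n => 15 * BinCovering.approxBits n + 6,
    fun n => 1200 / (2 : ℝ) ^ BinCovering.approxBits n, 600, BinCovering.isBigO_adviceBits,
    BinCovering.isBigO_div_two_pow_approxBits 1200, fun σ hσ => ?_⟩
  obtain ⟨t, covered⟩ := BinCovering.coversAtLeast_approxBits hσ
  exact ⟨t, (BinCovering.readLength_selfDelimited _ t).le, covered⟩
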